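/- Let $d_x,d_y$ be non-negative integers, let $A\in\mathbb{Q}[x,y]$ be a nonzero polynomial with $\deg_xA<d_x$ and $\deg_yA<d_y$, and let $B(x,y)=\sum_{i\le d_x,\,j\le d_y}b_{i,j}x^iy^j$, where the $b_{i,j}$ are indeterminates. Put $k=\mathbb{Q}((b_{i,j}))$ and $\mathbb{K}=k(t)$. Algorithm AlgebraicDiagonal, on input $A/B$, does the following. 1. Write $\frac1y\,\frac{A(t/y,y)}{B(t/y,y)}=\frac{P}{Q}$ with coprime $P,Q\in k[t,y]$. 2. (AlgebraicResidues) Take a squarefree decomposition $Q=Q_1Q_2^2\cdots Q_m^m$ in $\mathbb{K}[y]$, with the $Q_i$ squarefree and pairwise coprime and $\deg_y Q_m>0$. For each $i$ with $\deg_yQ_i>0$, set $U_i=Q/Q_i^i$ and $V_i(y,u)=(Q_i(y+u)-Q_i(y))/u$, write the coefficient of $u^{i-1}$ in the power series expansion at $u=0$ of $P(y+u)/(U_i(y+u)V_i(y,u)^i)$ as $A_i/B_i$ with coprime $A_i,B_i\in\mathbb{K}[y]$, and set $R_i(z)=\operatorname{Resultant}_y(A_i-zB_i,Q_i)$; for the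 other $i$ set $R_i=1$. Let $R=R_1\cdots R_m\in\mathbb{K}[z]$. 3. Let $c$ be the number of small branches of $Q$, i.e. of distinct roots $y$ of $Q(t,y)$ in an algebraic closure of $k((t))$ that tend to $0$ with $t$ (have positive valuation). 4. (PureComposedSum) Let $d=\deg R$, $D=\binom dc$ and $\operatorname{rec}(f)(u)=u^{\deg f}f(1/u)$. Compute $N=\operatorname{rec}(R')/\operatorname{rec}(R)\bmod u^{D+1}$; $S=N\odot\exp(u)\bmod u^{D+1}$, where $\odot$ is the coefficientwise product; $F=\exp\bigl(\sum_{n=1}^c(-1)^{n-1}\frac{S(nu)}{n}v^n\bigr)\bmod(u^{D+1},v^{c+1})$; $M=([v^c]F)\odot\sum_n n!\,u^n\bmod u^{D+1}$; and $\Psi=\operatorname{rec}\bigl(\exp\bigl(\int\frac{D-M}{u}\,du\bigr)\bmod u^{D+1}\bigr)$. 5. Return the numerator $\Phi(t,\Delta)\in k[t,\Delta]$ of $\Psi(\Delta)\in\mathbb{K}[\Delta]$, written in lowest terms with a denominator in $k[t]$. Then the algorithm has an output, and every polynomial $\Phi$ that it can output (for any admissible choice of the normalizations in its steps) is irreducible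 over $\mathbb{K}=\mathbb{Q}((b_{i,j});t)$ as a polynomial in $\Delta$, has degree $\binom{d_x+d_y}{d_x}$ in $\Delta$, and satisfies $\Phi(t,\operatorname{Diag}(A/B))=0$. Here $\operatorname{Diag}(A/B)=\sum_nf_{n,n}t^n\in k[[t]]$ is the diagonal of the expansion $A/B=\sum_{i,j\ge 0}f_{i,j}x^iy^j\in k[[x,y]]$. Consequently the minimal polynomial of $\operatorname{Diag}(A/B)$ over $\mathbb{K}$ has degree $\binom{d_x+d_y}{d_x}\ge2^{\min(d_x,d_y)}$, which is exponential in the degree of the input. -/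

import Mathlib

open Polynomial

noncomputable section

namespace AlgDiag

/-! ### Polynomials cancelling residues -/

section Residues

variable {F : Type*} [Field F]

/-- `Q = Q₁ Q₂² ⋯ Qₘᵐ` is a squarefree decomposition of `Q`: the `Qᵢ` (`1 ≤ i ≤ m`) are squarefree
and pairwise coprime and `Qₘ` is not constant. -/
structure IsSquarefreeDecomposition (Q : F[X]) (m : ℕ) (q : ℕ → F[X]) : Prop where
  one_le : 1 ≤ m
  prod_eq : Q = ∏ i ∈ Finset.Icc 1 m, q i ^ i
  squarefree : ∀ i ∈ Finset.Icc 1 m, Squarefree (q i)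
  coprime : ∀ i ∈ Finset.Icc 1 m, ∀ j ∈ Finset.Icc 1 m, i ≠ j → IsCoprime (q i) (q j)
  natDegree_pos : 0 < (q m).natDegree

/-- `p(y + t)`, as a polynomial in `t` with coefficients in the field `F(y)`. -/
def shift (p : F[X]) : (RatFunc F)[X] :=
  taylor RatFunc.X (p.map (algebraMap F (RatFunc F)))

/-- `(q(y + t) - q(y)) / t`, as a polynomial in `t` with coefficients in the field `F(y)`. -/
def diffQuot (q : F[X]) : (RatFunc F)[X] :=
  (shift q - C (algebraMap F[X] (RatFunc F) q)).divX

/-- For a factor `q` of multiplicity `i` in `Q`: the expansion at `t = 0`, in `F(y)⟦t⟧`, of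
`P(y + t) / (U(y + t) V(y, t)ⁱ)`, where `U = Q / qⁱ` and `V(y, t) = (q(y + t) - q(y)) / t`. -/
def residueSeries (P Q q : F[X]) (i : ℕ) : PowerSeries (RatFunc F) :=
  (shift P : PowerSeries (RatFunc F)) *
    ((shift (Q / q ^ i) * diffQuot q ^ i : (RatFunc F)[X]) : PowerSeries (RatFunc F))⁻¹

/-- `Resultant_y(a(y) - z b(y), q(y))`, a polynomial in `z`. -/
def residueResultant (a b q : F[X]) : F[X] :=
  resultant (a.map C - C X * b.map C : F[X][X]) (q.map C)

/-- `r` is the factor produced for the factor `q` of multiplicity `i` in `Q`. -/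
def IsResidueFactor (P Q q : F[X]) (i : ℕ) (r : F[X]) : Prop :=
  (q.natDegree = 0 ∧ r = 1) ∨
  (q.natDegree ≠ 0 ∧ ∃ a b : F[X], b ≠ 0 ∧ IsCoprime a b ∧
    PowerSeries.coeff (i - 1) (residueSeries P Q q i) =
      algebraMap F[X] (RatFunc F) a / algebraMap F[X] (RatFunc F) b ∧
    r = residueResultant a b q)

/-- `R` is a possible output of the algorithm **AlgebraicResidues** on `P / Q`. It depends on the
choice of a squarefree decomposition of `Q` and on the scaling of the fractions `a / b`. -/
def IsAlgebraicResidues (P Q R : F[X]) : Prop :=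
  ∃ (m : ℕ) (q r : ℕ → F[X]), IsSquarefreeDecomposition Q m q ∧
    (∀ i ∈ Finset.Icc 1 m, IsResidueFactor P Q (q i) i (r i)) ∧
    R = ∏ i ∈ Finset.Icc 1 m, r i

end Residues

/-! ### Polynomials cancelling sums of roots -/

section Sums

variable {F : Type*} [Field F] [CharZero F]

/-- The truncation `f mod yⁿ`, as a power series. -/
def modPow (n : ℕ) (f : PowerSeries F) : PowerSeries F :=
  (PowerSeries.trunc n f : F[X])

/-- The Hadamard product of two power series. -/
def hadamard (f g : PowerSeries F) : PowerSeries F :=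
  PowerSeries.mk fun n => PowerSeries.coeff n f * PowerSeries.coeff n g

/-- The series `exp(∑_{n=1}^c (-1)^{n-1} S(n y) zⁿ / n)` of `F⟦y⟧⟦z⟧`; the coefficients are series
in `y`, the outer variable is `z`. -/
def expSum (S : PowerSeries F) (c : ℕ) : PowerSeries (PowerSeries F) :=
  (PowerSeries.exp ℚ).subst
    (∑ n ∈ Finset.Icc 1 c, PowerSeries.monomial n
      (((-1 : F) ^ (n - 1) / (n : F)) • PowerSeries.rescale (n : F) S) :
        PowerSeries (PowerSeries F))

/-- The antiderivative without constant term of `f / y`, for `f` without constant term. -/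
def integralDivX (f : PowerSeries F) : PowerSeries F :=
  PowerSeries.mk fun n => PowerSeries.coeff n f / (n : F)

/-- The algorithm **PureComposedSum**: the polynomial whose roots are the sums of `c` roots of `P`,
computed from the generating series of Newton sums. `Polynomial.reverse` is the reciprocal
`y^{deg P} P(1/y)`. -/
def pureComposedSum (P : F[X]) (c : ℕ) : F[X] :=
  let D : ℕ := P.natDegree.choose c
  let N : PowerSeries F := modPow (D + 1)
    (((derivative P).reverse : PowerSeries F) * (P.reverse : PowerSeries F)⁻¹)
  let S : PowerSeries F := modPow (D + 1) (hadamard N (PowerSeries.exp F))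
  let E : PowerSeries F := modPow (D + 1) ((PowerSeries.trunc (c + 1) (expSum S c)).coeff c)
  let M : PowerSeries F := modPow (D + 1)
    (hadamard E (PowerSeries.mk fun n => (n.factorial : F)))
  (PowerSeries.trunc (D + 1)
    ((PowerSeries.exp ℚ).subst (integralDivX ((D : PowerSeries F) - M)) : PowerSeries F)).reverse

end Sums

/-! ### Diagonals -/

section Diagonal

variable {k : Type*} [Field k]

/-- An algebraic function `y` over `k((t))` tends to `0` with `t`, i.e. it has positive valuation:
some power `yⁿ`, `n ≥ 1`, is `t` times an element that is integral over `k⟦t⟧`. -/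
def TendsToZero (y : AlgebraicClosure (LaurentSeries k)) : Prop :=
  ∃ n : ℕ, 0 < n ∧ ∃ z : AlgebraicClosure (LaurentSeries k), IsIntegral (PowerSeries k) z ∧
    y ^ n = algebraMap (PowerSeries k) _ PowerSeries.X * z

/-- The embedding of `k[t]` in the algebraic closure of `k((t))`. -/
def polyToBranches (k : Type*) [Field k] : k[X] →+* AlgebraicClosure (LaurentSeries k) :=
  (algebraMap (PowerSeries k) (AlgebraicClosure (LaurentSeries k))).comp
    coeToPowerSeries.ringHom

/-- The number of small branches of `Q(t, y)` (`t` is the inner variable, `y` the outer one): the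
number of distinct roots `y(t)` that tend to `0` with `t`. -/
def numSmallBranches (Q : k[X][X]) : ℕ :=
  {y : AlgebraicClosure (LaurentSeries k) | (Q.map (polyToBranches k)).IsRoot y ∧
    TendsToZero y}.ncard

/-- `A(t / y, y)` in the field `k(t, y)`, the fraction field of `k[t][y]`. -/
def substDiag (A : MvPolynomial (Fin 2) k) : FractionRing k[X][X] :=
  MvPolynomial.aeval
    ![algebraMap k[X][X] (FractionRing k[X][X]) (C X) / algebraMap k[X][X] (FractionRing k[X][X]) X,
      algebraMap k[X][X] (FractionRing k[X][X]) X] A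

/-- `P / Q` is a reduced form of `(1 / y) (A / B)(t / y, y)`. -/
def IsReducedForm (A B : MvPolynomial (Fin 2) k) (P Q : k[X][X]) : Prop :=
  Q ≠ 0 ∧ IsRelPrime P Q ∧
    1 / algebraMap k[X][X] (FractionRing k[X][X]) X * (substDiag A / substDiag B) =
      algebraMap k[X][X] (FractionRing k[X][X]) P / algebraMap k[X][X] (FractionRing k[X][X]) Q

/-- View a polynomial of `k[t][y]` as a polynomial in `y` over the field `k(t)`. -/
def overRatFunc (P : k[X][X]) : (RatFunc k)[X] :=
  P.map (algebraMap k[X] (RatFunc k))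

/-- `Φ ∈ k[t][z]` is a numerator of `Ψ ∈ k(t)[z]`: `Ψ = Φ / e` in lowest terms, `e ∈ k[t]`. -/
def IsNumer (Ψ : (RatFunc k)[X]) (Φ : k[X][X]) : Prop :=
  ∃ e : k[X], e ≠ 0 ∧ IsRelPrime Φ (C e) ∧
    overRatFunc Φ = C (algebraMap k[X] (RatFunc k) e) * Ψ

/-- `Φ ∈ k[t][Δ]` is a possible output of the algorithm **AlgebraicDiagonal** on `A / B`. -/
def IsAlgebraicDiagonal [CharZero k] (A B : MvPolynomial (Fin 2) k) (Φ : k[X][X]) : Prop :=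
  ∃ (P Q : k[X][X]) (R : (RatFunc k)[X]), IsReducedForm A B P Q ∧
    IsAlgebraicResidues (overRatFunc P) (overRatFunc Q) R ∧
    IsNumer (pureComposedSum R (numSmallBranches Q)) Φ

/-- The diagonal `∑ₙ f_{n,n} tⁿ` of a bivariate power series `∑ f_{i,j} xⁱ yʲ`. -/
def diag (f : MvPowerSeries (Fin 2) k) : PowerSeries k :=
  PowerSeries.mk fun n => MvPowerSeries.coeff (Finsupp.single 0 n + Finsupp.single 1 n) f

/-- The diagonal of the power series expansion of `A / B` (where `B(0,0) ≠ 0`). -/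
def ratDiag (A B : MvPolynomial (Fin 2) k) : PowerSeries k :=
  diag ((A : MvPowerSeries (Fin 2) k) * (B : MvPowerSeries (Fin 2) k)⁻¹)

end Diagonal

section MinimalPolynomial

open scoped RatFunc

/-- The minimal polynomial over `k(t)` of a power series in `k⟦t⟧`, viewed in `k((t))`
(it is `0` if the series is not algebraic). -/
def seriesMinpoly {k : Type*} [Field k] (f : PowerSeries k) : (RatFunc k)[X] :=
  minpoly (RatFunc k) (algebraMap (PowerSeries k) (LaurentSeries k) f)

end MinimalPolynomial

/-! ### The generic denominator -/

/-- The field `ℚ(b_{i,j})` in the indeterminates `b_{i,j}`, `0 ≤ i ≤ dx`, `0 ≤ j ≤ dy`. -/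
abbrev GenericField (dx dy : ℕ) : Type :=
  FractionRing (MvPolynomial (Fin (dx + 1) × Fin (dy + 1)) ℚ)

/-- `B(x, y) = ∑_{i ≤ dx, j ≤ dy} b_{i,j} xⁱ yʲ`. -/
def genericB (dx dy : ℕ) : MvPolynomial (Fin 2) (GenericField dx dy) :=
  ∑ i : Fin (dx + 1), ∑ j : Fin (dy + 1),
    MvPolynomial.C (algebraMap (MvPolynomial (Fin (dx + 1) × Fin (dy + 1)) ℚ) (GenericField dx dy)
        (MvPolynomial.X (i, j))) *
      MvPolynomial.X 0 ^ (i : ℕ) * MvPolynomial.X 1 ^ (j : ℕ)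

/-- `A ∈ ℚ[x, y]` viewed over `ℚ(b_{i,j})`. -/
def extendA (dx dy : ℕ) (A : MvPolynomial (Fin 2) ℚ) : MvPolynomial (Fin 2) (GenericField dx dy) :=
  MvPolynomial.map (algebraMap ℚ (GenericField dx dy)) A

end AlgDiag

end

/-! Put `Q = y^dx B(t/y, y)`, of degree `n = dx + dy` in `y`, and `P = y^(dx-1) A(t/y, y)`; up to a
common constant, `P/Q` is the reduced form of step 1. The proof has a symmetric half and an analytic
half.

Symmetry. Since the `b_{i,j}` are indeterminates, the roots of `Q` can be permuted arbitrarily over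
`k(t)`. No Galois group is computed: `exists_hasSymmetricRoots` embeds `k(t)` in a field of rational
functions in `n` variables so that the roots of `Q` become the variables, and permuting the
variables fixes the image of `k(t)`. Hence `Q` is irreducible, its squarefree decomposition is
trivial, and `R` has as roots the residues `r_i = P(Y_i)/Q'(Y_i)`, which are permuted in the same
way. As `deg P ≤ n - 2`, the residues sum to `0`; if they were all equal they would all vanish,
forcing `P = 0`. So some two differ, and a transposition argument shows that sums over distinct
`c`-subsets differ. For `0 < c < n` these sums are nonzero and permuted transitively, so the
polynomial with these roots is irreducible of degree `binom(n, c)`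
(`HasSymmetricRoots.irreducible_pureComposedSum`). That step 4 computes this polynomial is Newton's
identities, used twice (`map_pureComposedSum`).

Analysis. At `t = 0`, `Q` is `y^dx B(0, y)` with `B(0, 0) ≠ 0`, so Weierstrass preparation gives `Q
= W H`, where the roots of `W` are the `dx` small branches, and `P/Q = U/W + V/H`. The coefficient
of `1/y` in `P/Q`, expanded in `k((y))⟦t⟧`, is the diagonal; `V/H` does not contribute, and `U/W`
contributes the coefficient of `y^(dx-1)` in `U`, which is also the sum of the residues at the small
branches. So the diagonal is one of the sums of `dx` residues, hence a root of the output
(`IsAlgebraicDiagonal.irreducible_and_isRoot`). -/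

noncomputable section

namespace AlgDiag

/-! ### Newton's identities and the exponential of a power series -/

section ExpRecursion

open Finset in
/-- Newton's identities for the elementary symmetric functions of a finite family. -/
lemma succ_mul_sum_powersetCard_prod {T ι : Type*} [CommRing T] [Fintype ι] (e : ι → T) (n : ℕ) :
    ((n + 1 : ℕ) : T) * ∑ I ∈ powersetCard (n + 1) univ, ∏ i ∈ I, e i =
      ∑ p ∈ antidiagonal n, ((-1) ^ p.1 * ∑ i, e i ^ (p.1 + 1)) *
        ∑ I ∈ powersetCard p.2 univ, ∏ i ∈ I, e i := by
  have h := congrArg (MvPolynomial.aeval (R := ℤ) e) (MvPolynomial.mul_esymm_eq_sum ι ℤ (n + 1))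
  simp only [map_mul, map_natCast, map_pow, map_neg, map_one, map_sum, MvPolynomial.esymm,
    MvPolynomial.psum, MvPolynomial.aeval_X, map_prod] at h
  rw [h, mul_sum]
  refine sum_nbij' (fun a => (a.2 - 1, a.1)) (fun p => (p.2, p.1 + 1)) ?_ ?_ ?_ ?_ ?_
  · rintro ⟨a, b⟩ h
    simp only [mem_filter, HasAntidiagonal.mem_antidiagonal] at h ⊢
    omega
  · rintro ⟨a, b⟩ h
    simp only [mem_filter, HasAntidiagonal.mem_antidiagonal] at h ⊢
    omega
  · rintro ⟨a, b⟩ h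
    simp only [mem_filter, HasAntidiagonal.mem_antidiagonal, Prod.mk.injEq, true_and] at h ⊢
    omega
  · rintro ⟨a, b⟩ h
    simp
  rintro ⟨a, b⟩ hp
  simp only [mem_filter, HasAntidiagonal.mem_antidiagonal] at hp ⊢
  obtain ⟨b, rfl⟩ : ∃ c, b = c + 1 := ⟨b - 1, by omega⟩
  simp only [Nat.add_sub_cancel]
  have : (-1 : T) ^ (n + 1 + 1) = (-1) ^ b * (-1) ^ a := by
    rw [← pow_add, show n + 1 + 1 = b + a + 2 by omega, pow_add]; ring
  rw [this]
  have h2 : (-1 : T) ^ a * (-1) ^ a = 1 := by rw [← mul_pow]; simp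
  linear_combination ((-1) ^ b * (∑ i, e i ^ (b + 1)) *
        ∑ I ∈ powersetCard a univ, ∏ i ∈ I, e i) * h2

variable {S : Type*} [CommRing S] [Algebra ℚ S]

lemma exp_subst_eq {g : PowerSeries S} (hg : PowerSeries.HasSubst g) :
    (PowerSeries.exp ℚ).subst g = (PowerSeries.exp S).subst g := by
  ext n
  rw [PowerSeries.coeff_subst' hg, PowerSeries.coeff_subst' hg]
  refine finsum_congr fun d => ?_
  simp [PowerSeries.coeff_exp, Algebra.smul_def]

lemma coeff_zero_exp_subst {g : PowerSeries S} (hg : PowerSeries.constantCoeff g = 0) :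
    PowerSeries.coeff 0 ((PowerSeries.exp ℚ).subst g) = 1 := by
  rw [PowerSeries.coeff_subst' (PowerSeries.HasSubst.of_constantCoeff_zero' hg),
    finsum_eq_single _ 0]
  · simp
  · intro d hd
    simp [hg, hd]

-- The coefficientwise form of `(exp g)' = g' exp g`. It has the same shape as Newton's identities,
-- which is what links exponentials to elementary symmetric functions.
open Finset in
lemma coeff_succ_exp_subst {g : PowerSeries S} (hg : PowerSeries.constantCoeff g = 0) (n : ℕ) :
    ((n + 1 : ℕ) : S) * PowerSeries.coeff (n + 1) ((PowerSeries.exp ℚ).subst g) =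
      ∑ p ∈ antidiagonal n, (((p.1 + 1 : ℕ) : S) * PowerSeries.coeff (p.1 + 1) g) *
        PowerSeries.coeff p.2 ((PowerSeries.exp ℚ).subst g) := by
  have hs := PowerSeries.HasSubst.of_constantCoeff_zero' hg
  have h := congrArg (PowerSeries.coeff n)
    (PowerSeries.derivative_subst (f := PowerSeries.exp S) hs)
  rw [PowerSeries.derivative_exp, PowerSeries.coeff_derivative, ← exp_subst_eq hs,
    mul_comm _ (PowerSeries.derivative S g), PowerSeries.coeff_mul] at h
  simp only [PowerSeries.coeff_derivative] at h
  push_cast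
  rw [mul_comm, h]
  refine sum_congr rfl fun p _ => by ring

open Finset in
/-- If the coefficients of `g` are, up to sign and factor, power sums of the `e i`, then the
coefficients of `exp(g)` are the elementary symmetric functions of the `e i`. -/
lemma coeff_exp_subst_eq_esymm {T ι : Type*} [CommRing T] [Algebra ℚ T] [Fintype ι] (π : S →+* T)
    (e : ι → T) {g : PowerSeries S} (hg : PowerSeries.constantCoeff g = 0) (N : ℕ)
    (h : ∀ n < N, ((n + 1 : ℕ) : T) * π (PowerSeries.coeff (n + 1) g) =
      (-1) ^ n * ∑ i, e i ^ (n + 1)) :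
    ∀ n ≤ N, π (PowerSeries.coeff n ((PowerSeries.exp ℚ).subst g)) =
      ∑ I ∈ powersetCard n univ, ∏ i ∈ I, e i := by
  intro n
  induction n using Nat.strong_induction_on with
  | _ n ih =>
  intro hn
  cases n with
  | zero => rw [coeff_zero_exp_subst hg]; simp
  | succ n =>
    have hu : IsUnit ((n + 1 : ℕ) : T) := by
      have : IsUnit ((n + 1 : ℕ) : ℚ) := by
        rw [isUnit_iff_ne_zero]; positivity
      simpa using this.map (algebraMap ℚ T)
    apply hu.mul_left_cancel
    -- Both sides obey the same recurrence, and `n + 1` is invertible. The map `π` allows the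
    -- comparison to take place after truncation or in an extension field.
    rw [succ_mul_sum_powersetCard_prod, ← map_natCast π, ← map_mul, coeff_succ_exp_subst hg,
      map_sum]
    refine sum_congr rfl fun p hp => ?_
    rw [HasAntidiagonal.mem_antidiagonal] at hp
    rw [map_mul, ih p.2 (by omega) (by omega), map_mul, map_natCast, h p.1 (by omega)]

end ExpRecursion

/-! ### Reciprocal polynomials of split polynomials -/

section Reverse

variable {E ι : Type*} [Field E]

lemma reverse_X_sub_C (s : E) : (X - C s : E[X]).reverse = 1 - C s * X := by
  ext n
  rw [coeff_reverse, natDegree_X_sub_C]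
  rcases n with _ | _ | n
  · simp [revAt_le]
  · simp [revAt_le, coeff_X, coeff_one]
  · rw [revAt_eq_self_of_lt (by omega)]
    simp [coeff_X, coeff_one]

lemma reverse_prod_X_sub_C (s : Finset ι) (f : ι → E) :
    (∏ i ∈ s, (X - C (f i))).reverse = ∏ i ∈ s, (1 - C (f i) * X) := by
  classical
  induction s using Finset.induction_on with
  | empty => simpa using reverse_C (1 : E)
  | insert a s ha ih =>
    rw [Finset.prod_insert ha, Finset.prod_insert ha, reverse_mul_of_domain, ih, reverse_X_sub_C]

lemma reverse_map_of_field {F : Type*} [Field F] (θ : F →+* E) (p : F[X]) :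
    p.reverse.map θ = (p.map θ).reverse := by
  rw [reverse, reverse, reflect_map, natDegree_map]

lemma reverse_reverse_of_coeff_zero_ne {p : E[X]} (hp : p.coeff 0 ≠ 0) :
    p.reverse.reverse = p := by
  have h0 : p.reverse.natDegree = p.natDegree := by
    rw [reverse_natDegree, natTrailingDegree_eq_zero.2 (Or.inr hp), Nat.sub_zero]
  ext n
  rw [coeff_reverse, coeff_reverse, h0, revAt_invol]

/-- The factor `1 - f i X` drops in degree exactly when `f i = 0`, so the degree of the reciprocal
detects zero roots. -/
lemma natDegree_reverse_prod_X_sub_C (s : Finset ι) (f : ι → E) :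
    (∏ i ∈ s, (X - C (f i))).reverse.natDegree = s.card ↔ ∀ i ∈ s, f i ≠ 0 := by
  classical
  rw [reverse_prod_X_sub_C]
  have hne : ∀ i ∈ s, (1 - C (f i) * X : E[X]) ≠ 0 := fun i _ h => by
    have := congrArg (fun p => p.coeff 0) h
    simp at this
  have hle : ∀ i ∈ s, (1 - C (f i) * X : E[X]).natDegree ≤ 1 := fun i _ => by
    compute_degree
  rw [natDegree_prod _ _ hne]
  have h1 : ∀ a : E, (1 - C a * X : E[X]).natDegree = 1 ↔ a ≠ 0 := by
    intro a
    constructor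
    · rintro h rfl
      simp at h
    · intro ha
      have : (1 - C a * X : E[X]) = C (-a) * X + C 1 := by simp; ring
      rw [this, natDegree_linear (neg_ne_zero.2 ha)]
  constructor
  · intro h i hi
    rw [← h1]
    by_contra hc
    have hlt : ∑ i ∈ s, (1 - C (f i) * X : E[X]).natDegree < ∑ i ∈ s, 1 :=
      Finset.sum_lt_sum hle ⟨i, hi, lt_of_le_of_ne (hle i hi) hc⟩
    simp [h] at hlt
  · intro h
    rw [Finset.sum_congr rfl fun i hi => (h1 _).2 (h i hi)]
    simp

end Reverse

/-! ### Correctness of `PureComposedSum` -/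

section PureComposedSum

open Finset

variable {F E ι : Type*} [Field F] [Field E] [CharZero E] [Fintype ι]

/-- The generating series of the power sums of the roots. -/
lemma coeff_reverse_derivative_mul_inv (θ : F →+* E) {P : F[X]} {a : E} (ha : a ≠ 0)
    {r : ι → E} (hP : P.map θ = C a * ∏ i, (X - C (r i))) (m : ℕ) :
    θ (PowerSeries.coeff m (((derivative P).reverse : PowerSeries F) *
      (P.reverse : PowerSeries F)⁻¹)) = ∑ i, r i ^ m := by
  classical
  have hP0 : P ≠ 0 := by
    rintro rfl
    rw [Polynomial.map_zero, eq_comm] at hP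
    exact mul_ne_zero (C_ne_zero.2 ha) (Finset.prod_ne_zero_iff.2 fun i _ => X_sub_C_ne_zero _) hP
  set N := (((derivative P).reverse : PowerSeries F) * (P.reverse : PowerSeries F)⁻¹) with hN
  have h1 : N * (P.reverse : PowerSeries F) = ((derivative P).reverse : PowerSeries F) := by
    rw [hN, mul_assoc, PowerSeries.inv_mul_cancel, mul_one]
    simp [hP0]
  have h2 := congrArg (PowerSeries.map θ) h1
  rw [map_mul, ← Polynomial.polynomial_map_coe, ← Polynomial.polynomial_map_coe,
    reverse_map_of_field, reverse_map_of_field, ← derivative_map] at h2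
  set n := Fintype.card ι
  have hdeg : (P.map θ).natDegree = n := by
    rw [hP, natDegree_C_mul ha, natDegree_prod_of_monic _ _ fun i _ => monic_X_sub_C _]
    simp [n]
  have hd : derivative (P.map θ) = C a * ∑ i, ∏ j ∈ univ.erase i, (X - C (r j)) := by
    rw [hP, derivative_C_mul, derivative_prod_finset]
    simp
  have hr : (P.map θ).reverse = C a * ∏ i, (1 - C (r i) * X) := by
    rw [hP, reverse_mul_of_domain, reverse_prod_X_sub_C, reverse_C]
  have hrd : (derivative (P.map θ)).reverse =
      C a * ∑ i, ∏ j ∈ univ.erase i, (1 - C (r j) * X) := by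
    -- In characteristic zero the derivative has degree exactly `n - 1`, so each of its summands is
    -- reflected at its own degree.
    rw [reverse, natDegree_derivative, hdeg, hd, reflect_C_mul]
    congr 1
    rw [show reflect (n - 1) (∑ i, ∏ j ∈ univ.erase i, (X - C (r j))) =
      ∑ i, reflect (n - 1) (∏ j ∈ univ.erase i, (X - C (r j))) from
      map_sum (⟨⟨reflect (n - 1), reflect_zero⟩, fun f g => reflect_add f g _⟩ : E[X] →+ E[X]) _ _]
    refine sum_congr rfl fun i _ => ?_
    rw [← reverse_prod_X_sub_C, reverse, natDegree_prod_of_monic _ _ fun i _ => monic_X_sub_C _]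
    simp [n, Finset.card_erase_of_mem]
  have hgeom : ∀ i, (PowerSeries.mk fun m => r i ^ m) * ((1 - C (r i) * X : E[X]) : PowerSeries E)
      = 1 := by
    intro i
    ext m
    rw [Polynomial.coe_sub, Polynomial.coe_mul, Polynomial.coe_one, Polynomial.coe_C,
      Polynomial.coe_X, mul_sub, mul_one, ← mul_assoc, map_sub]
    cases m with
    | zero => simp
    | succ m => simp [PowerSeries.coeff_succ_mul_X, PowerSeries.coeff_one, pow_succ]
  -- The logarithmic derivative: in the `i`-th term, `1/(1 - r_i u)` cancels its own factor of the
  -- reciprocal of `P`.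
  have h3 : (∑ i, PowerSeries.mk fun m => r i ^ m) * ((P.map θ).reverse : PowerSeries E) =
      ((derivative (P.map θ)).reverse : PowerSeries E) := by
    rw [hr, hrd]
    simp only [← coeToPowerSeries.ringHom_apply, map_mul, map_sum, map_prod]
    rw [mul_left_comm, sum_mul]
    congr 1
    refine sum_congr rfl fun i _ => ?_
    rw [← mul_prod_erase univ _ (mem_univ i), ← mul_assoc]
    simp only [coeToPowerSeries.ringHom_apply]
    rw [hgeom, one_mul]
  have h4 : PowerSeries.map θ N = ∑ i, PowerSeries.mk fun m => r i ^ m := by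
    refine mul_right_cancel₀ (b := ((P.map θ).reverse : PowerSeries E)) ?_ (h2.trans h3.symm)
    intro h0
    have := congrArg (PowerSeries.coeff 0) h0
    rw [Polynomial.coeff_coe, coeff_zero_reverse] at this
    simp [hP0] at this
  rw [← PowerSeries.coeff_map, h4]
  simp

omit [CharZero E] in
lemma coeff_prod_one_sub_C_mul_X (f : ι → E) (m : ℕ) :
    (∏ i, (1 - C (f i) * X)).coeff m = ∑ I ∈ powersetCard m univ, ∏ i ∈ I, -f i := by
  classical
  simp_rw [sub_eq_add_neg]
  rw [prod_one_add, finsetSum_coeff, powersetCard_eq_filter, sum_filter]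
  refine sum_congr rfl fun I _ => ?_
  have : ∏ i ∈ I, -(C (f i) * X : E[X]) = C (∏ i ∈ I, -f i) * X ^ I.card := by
    rw [map_prod, ← prod_const, ← prod_mul_distrib]
    exact prod_congr rfl fun i _ => by simp
  rw [this, coeff_C_mul_X_pow]
  simp only [eq_comm]

omit [Fintype ι] in
lemma prod_rescale_exp (r : ι → E) (I : Finset ι) :
    ∏ i ∈ I, PowerSeries.rescale (r i) (PowerSeries.exp E) =
      PowerSeries.rescale (∑ i ∈ I, r i) (PowerSeries.exp E) := by
  classical
  induction I using Finset.induction_on with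
  | empty => simp
  | insert a s ha ih =>
    rw [prod_insert ha, sum_insert ha, ih, PowerSeries.exp_mul_exp_eq_exp_add]

omit [CharZero E] in
lemma coeff_modPow {n m : ℕ} (h : m < n) (f : PowerSeries E) :
    PowerSeries.coeff m (modPow n f) = PowerSeries.coeff m f := by
  rw [modPow, PowerSeries.coeff_coe_trunc_of_lt h]

omit [CharZero E] in
lemma map_coeff_exp [CharZero F] (θ : F →+* E) (m : ℕ) :
    θ (PowerSeries.coeff m (PowerSeries.exp F)) = ((m.factorial : E))⁻¹ := by
  simp [PowerSeries.coeff_exp]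

/-- The coefficients of the exponential series of `PureComposedSum` are the exponential generating
series of the power sums of the sums of `c` elements. -/
lemma map_coeff_coeff_expSum [CharZero F] (θ : F →+* E) (r : ι → E) (S : PowerSeries F) (c D : ℕ)
    (hS : ∀ m ≤ D, θ (PowerSeries.coeff m S) = (∑ i, r i ^ m) * (m.factorial : E)⁻¹) (m : ℕ)
    (hm : m ≤ D) :
    θ (PowerSeries.coeff m (PowerSeries.coeff c (expSum S c))) =
      (∑ I ∈ powersetCard c univ, (∑ i ∈ I, r i) ^ m) * (m.factorial : E)⁻¹ := by
  classical
  -- `S` is known only up to degree `D`, so the computation is done modulo `u^(D+1)`. There `S(nu)`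
  -- is `∑ exp(r_i u)^n`, the `n`-th power sum of the `exp(r_i u)`; the exponential in `v` then
  -- yields their elementary symmetric functions, whose terms are `exp((∑_{i ∈ I} r_i) u)`.
  let J : Ideal (PowerSeries E) := Ideal.span {PowerSeries.X ^ (D + 1)}
  let π : PowerSeries F →+* PowerSeries E ⧸ J := (Ideal.Quotient.mk J).comp (PowerSeries.map θ)
  have hJ : ∀ f g : PowerSeries E, Ideal.Quotient.mk J f = Ideal.Quotient.mk J g ↔
      ∀ m ≤ D, PowerSeries.coeff m f = PowerSeries.coeff m g := by
    intro f g
    rw [Ideal.Quotient.eq, Ideal.mem_span_singleton, PowerSeries.X_pow_dvd_iff]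
    refine forall_congr' fun m => ?_
    rw [map_sub, sub_eq_zero, Nat.lt_succ_iff]
  set g : PowerSeries (PowerSeries F) := ∑ n ∈ Finset.Icc 1 c, PowerSeries.monomial n
      (((-1 : F) ^ (n - 1) / (n : F)) • PowerSeries.rescale (n : F) S) with hg
  have hcoeff : ∀ n < c, PowerSeries.coeff (n + 1) g =
      ((-1 : F) ^ n / ((n + 1 : ℕ) : F)) • PowerSeries.rescale ((n + 1 : ℕ) : F) S := by
    intro n hn
    rw [hg, map_sum, sum_eq_single (n + 1)]
    · rw [PowerSeries.coeff_monomial_same, Nat.add_sub_cancel]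
    · intro b _ hb
      rw [PowerSeries.coeff_monomial, if_neg hb.symm]
    · intro h
      exact absurd (mem_Icc.2 ⟨by omega, by omega⟩) h
  have hg0 : PowerSeries.constantCoeff g = 0 := by
    rw [← PowerSeries.coeff_zero_eq_constantCoeff_apply, hg, map_sum]
    refine sum_eq_zero fun n hn => ?_
    rw [PowerSeries.coeff_monomial, if_neg]
    have := (mem_Icc.1 hn).1
    omega
  have key := coeff_exp_subst_eq_esymm π
    (fun i => Ideal.Quotient.mk J (PowerSeries.rescale (r i) (PowerSeries.exp E))) hg0 c ?_ c le_rfl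
  · have h2 : ∑ I ∈ powersetCard c univ, ∏ i ∈ I,
        Ideal.Quotient.mk J (PowerSeries.rescale (r i) (PowerSeries.exp E)) =
        Ideal.Quotient.mk J (∑ I ∈ powersetCard c univ,
          PowerSeries.rescale (∑ i ∈ I, r i) (PowerSeries.exp E)) := by
      rw [map_sum]
      refine sum_congr rfl fun I _ => ?_
      rw [← prod_rescale_exp, map_prod]
    rw [h2] at key
    have := (hJ _ _).1 key m hm
    rw [PowerSeries.coeff_map] at this
    rw [expSum, this, map_sum, sum_mul]
    refine sum_congr rfl fun I _ => ?_
    rw [PowerSeries.coeff_rescale]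
    congr 1
    simp
  · intro n hn
    have hn0 : ((n + 1 : ℕ) : F) ≠ 0 := Nat.cast_ne_zero.2 n.succ_ne_zero
    have h1 : ((n + 1 : ℕ) : PowerSeries E ⧸ J) * π (PowerSeries.coeff (n + 1) g) =
        Ideal.Quotient.mk J (PowerSeries.C ((-1) ^ n) *
          PowerSeries.map θ (PowerSeries.rescale ((n + 1 : ℕ) : F) S)) := by
      rw [← map_natCast π, ← map_mul, hcoeff n hn]
      simp only [π, RingHom.comp_apply]
      congr 1
      ext j
      rw [← map_natCast (PowerSeries.C (R := F)), PowerSeries.coeff_map,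
        PowerSeries.coeff_C_mul, PowerSeries.coeff_smul, PowerSeries.coeff_C_mul,
        PowerSeries.coeff_map, smul_eq_mul, ← mul_assoc, mul_div_cancel₀ _ hn0]
      simp
    have h2 : (-1) ^ n * ∑ i, Ideal.Quotient.mk J
          (PowerSeries.rescale (r i) (PowerSeries.exp E)) ^ (n + 1) =
        Ideal.Quotient.mk J (PowerSeries.C ((-1) ^ n) *
          ∑ i, PowerSeries.rescale (r i) (PowerSeries.exp E) ^ (n + 1)) := by
      simp
    rw [h1, h2, hJ]
    intro j hj
    rw [PowerSeries.coeff_C_mul, PowerSeries.coeff_C_mul]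
    congr 1
    rw [PowerSeries.coeff_map, PowerSeries.coeff_rescale, map_mul, hS j hj, map_sum, sum_mul,
      mul_sum]
    refine sum_congr rfl fun i _ => ?_
    rw [← map_pow, PowerSeries.exp_pow_eq_rescale_exp, PowerSeries.coeff_rescale,
      PowerSeries.coeff_rescale, ← RingHom.id_apply (PowerSeries.coeff j (PowerSeries.exp E)),
      map_coeff_exp]
    simp
    ring

/-- Up to a power of the variable, `PureComposedSum` computes the polynomial whose roots are the
sums of `c` roots of `P`. -/
theorem map_pureComposedSum [CharZero F] (θ : F →+* E) {P : F[X]} {a : E} (ha : a ≠ 0)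
    {r : ι → E} (hP : P.map θ = C a * ∏ i, (X - C (r i))) (c : ℕ) :
    (pureComposedSum P c).map θ =
      (∏ I ∈ powersetCard c univ, (X - C (∑ i ∈ I, r i))).reverse.reverse := by
  classical
  have hdeg : P.natDegree = Fintype.card ι := by
    rw [← natDegree_map θ, hP, natDegree_C_mul ha,
      natDegree_prod_of_monic _ _ fun i _ => monic_X_sub_C _]
    simp
  have hD : (powersetCard c (univ : Finset ι)).card = P.natDegree.choose c := by
    rw [card_powersetCard, card_univ, hdeg]
  unfold pureComposedSum
  extract_lets D N S G M
  rw [reverse_map_of_field]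
  congr 1
  have hN : ∀ m ≤ D, θ (PowerSeries.coeff m N) = ∑ i, r i ^ m := by
    intro m hm
    rw [coeff_modPow (by omega), coeff_reverse_derivative_mul_inv θ ha hP]
  have hS : ∀ m ≤ D, θ (PowerSeries.coeff m S) = (∑ i, r i ^ m) * (m.factorial : E)⁻¹ := by
    intro m hm
    rw [coeff_modPow (by omega), hadamard, PowerSeries.coeff_mk, map_mul, hN m hm, map_coeff_exp]
  have hM : ∀ m ≤ D, θ (PowerSeries.coeff m M) =
      ∑ I ∈ powersetCard c univ, (∑ i ∈ I, r i) ^ m := by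
    intro m hm
    rw [coeff_modPow (by omega), hadamard, PowerSeries.coeff_mk, map_mul, coeff_modPow (by omega),
      PowerSeries.coeff_trunc, if_pos (by omega), map_coeff_coeff_expSum θ r S c D hS m hm,
      PowerSeries.coeff_mk, map_natCast, mul_assoc, inv_mul_cancel₀, mul_one]
    exact Nat.cast_ne_zero.2 m.factorial_ne_zero
  have key := coeff_exp_subst_eq_esymm θ
    (fun I : powersetCard c (univ : Finset ι) => -∑ i ∈ I.1, r i)
    (g := integralDivX ((D : PowerSeries F) - M)) (by
      -- The constant term of `integralDivX` is a division by `0`, hence `0`, whatever the constant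
      -- term of `D - M` is.
      rw [← PowerSeries.coeff_zero_eq_constantCoeff_apply]
      simp [integralDivX]) D ?_
  · rw [reverse_prod_X_sub_C, ← Finset.prod_coe_sort]
    ext m
    rw [coeff_map, PowerSeries.coeff_trunc, coeff_prod_one_sub_C_mul_X]
    split_ifs with hm
    · rw [key m (by omega)]
    · have hcard : #(univ : Finset (powersetCard c (univ : Finset ι))) < m := by
        rw [card_univ, Fintype.card_coe, hD]
        omega
      rw [map_zero, powersetCard_eq_empty.2 hcard, sum_empty]
  · intro n hn
    have hn0 : ((n + 1 : ℕ) : E) ≠ 0 := Nat.cast_ne_zero.2 n.succ_ne_zero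
    have h0 : PowerSeries.coeff (n + 1) (D : PowerSeries F) = 0 := by
      rw [← map_natCast (PowerSeries.C (R := F)), PowerSeries.coeff_C, if_neg n.succ_ne_zero]
    rw [integralDivX, PowerSeries.coeff_mk, map_div₀, map_natCast, mul_div_cancel₀ _ hn0, map_sub,
      h0, zero_sub, map_neg, hM _ (by omega), ← Finset.sum_coe_sort, mul_sum, ← sum_neg_distrib]
    refine sum_congr rfl fun I _ => ?_
    rw [neg_pow (∑ i ∈ I.1, r i), ← mul_assoc, ← pow_add, show n + (n + 1) = 2 * n + 1 by ring,
      pow_succ (-1 : E), pow_mul]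
    simp

/-- If its degree is the number of sums, the output of `PureComposedSum` has the sums of `c` roots
of `P` as roots. -/
theorem map_pureComposedSum_of_natDegree [CharZero F] (θ : F →+* E) {P : F[X]} {a : E}
    (ha : a ≠ 0) {r : ι → E} (hP : P.map θ = C a * ∏ i, (X - C (r i))) (c : ℕ)
    (h : (pureComposedSum P c).natDegree = (Fintype.card ι).choose c) :
    (pureComposedSum P c).map θ = ∏ I ∈ powersetCard c univ, (X - C (∑ i ∈ I, r i)) := by
  rw [map_pureComposedSum θ ha hP]
  -- Reversing twice removes the zero roots, so full degree means that no sum vanishes.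
  apply reverse_reverse_of_coeff_zero_ne
  have h1 := natDegree_map (f := θ) (p := pureComposedSum P c)
  rw [map_pureComposedSum θ ha hP, h, reverse_natDegree,
    natTrailingDegree_eq_zero.2 (Or.inr ?_), Nat.sub_zero, ← card_univ, ← card_powersetCard,
    natDegree_reverse_prod_X_sub_C] at h1
  · rw [coeff_zero_eq_eval_zero, eval_prod, prod_ne_zero_iff]
    intro I hI
    rw [eval_sub, eval_X, eval_C, zero_sub, neg_ne_zero]
    exact h1 I hI
  · rw [coeff_zero_reverse, leadingCoeff_ne_zero]
    exact (monic_prod_of_monic _ _ fun i _ => monic_X_sub_C _).ne_zero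

/-- Meant for the field where symmetry excludes vanishing sums. The degree obtained there makes
`map_pureComposedSum_of_natDegree` applicable in any other splitting field. -/
theorem map_pureComposedSum_of_ne_zero [CharZero F] (θ : F →+* E) {P : F[X]} {a : E}
    (ha : a ≠ 0) {r : ι → E} (hP : P.map θ = C a * ∏ i, (X - C (r i))) (c : ℕ)
    (h : ∀ I ∈ powersetCard c univ, ∑ i ∈ I, r i ≠ 0) :
    (pureComposedSum P c).map θ = ∏ I ∈ powersetCard c univ, (X - C (∑ i ∈ I, r i)) := by
  rw [map_pureComposedSum θ ha hP]
  apply reverse_reverse_of_coeff_zero_ne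
  rw [coeff_zero_eq_eval_zero, eval_prod, prod_ne_zero_iff]
  intro I hI
  rw [eval_sub, eval_X, eval_C, zero_sub, neg_ne_zero]
  exact h I hI

end PureComposedSum

/-! ### Correctness of `AlgebraicResidues` for an irreducible denominator -/

section Residues

variable {F : Type*} [Field F]

lemma eval_derivative_C_mul_prod {ι : Type*} [Fintype ι] [DecidableEq ι] (l : F) (Y : ι → F)
    (i : ι) : (derivative (C l * ∏ i, (X - C (Y i)))).eval (Y i) =
      l * ∏ j ∈ Finset.univ.erase i, (Y i - Y j) := by
  rw [derivative_C_mul, eval_C_mul, ← Lagrange.nodal_eq,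
    Lagrange.eval_nodal_derivative_eval_node_eq (Finset.mem_univ i), Lagrange.eval_nodal]

lemma eval_derivative_C_mul_prod_ne_zero {ι : Type*} [Fintype ι] {l : F} (hl : l ≠ 0) {Y : ι → F}
    (hY : Function.Injective Y) (i : ι) :
    (derivative (C l * ∏ i, (X - C (Y i)))).eval (Y i) ≠ 0 := by
  classical
  rw [eval_derivative_C_mul_prod]
  refine mul_ne_zero hl (Finset.prod_ne_zero_iff.2 fun j hj => sub_ne_zero.2 fun h => ?_)
  exact Finset.ne_of_mem_erase hj (hY h.symm)

/-- The sum of the residues of a rational function with simple poles, read at infinity. -/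
lemma sum_eval_div_eval_derivative {ι : Type*} [Fintype ι] {l : F} {Y : ι → F}
    (hY : Function.Injective Y) {p : F[X]} (hp : p.degree < Fintype.card ι) :
    ∑ i, p.eval (Y i) / (derivative (C l * ∏ i, (X - C (Y i)))).eval (Y i) =
      p.coeff (Fintype.card ι - 1) / l := by
  classical
  rw [← Finset.card_univ, Lagrange.coeff_eq_sum hY.injOn (by rwa [Finset.card_univ]),
    Finset.sum_div]
  refine Finset.sum_congr rfl fun i _ => ?_
  rw [eval_derivative_C_mul_prod, div_div, mul_comm]

lemma coeff_zero_shift (p : F[X]) : (shift p).coeff 0 = algebraMap F[X] (RatFunc F) p := by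
  rw [shift, taylor_coeff_zero, eval_map_algebraMap, ← RatFunc.algebraMap_X,
    aeval_algebraMap_apply, aeval_X_left_apply]

lemma coeff_zero_diffQuot (q : F[X]) :
    (diffQuot q).coeff 0 = algebraMap F[X] (RatFunc F) (derivative q) := by
  rw [diffQuot, coeff_divX, coeff_sub, zero_add, coeff_C_succ, sub_zero, shift, taylor_coeff_one,
    derivative_map, eval_map_algebraMap, ← RatFunc.algebraMap_X,
    aeval_algebraMap_apply, aeval_X_left_apply]

/-- For a simple factor the residue is `P / Q'`. -/
lemma coeff_zero_residueSeries (P : F[X]) {Q : F[X]} (hQ : Q ≠ 0) :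
    PowerSeries.coeff 0 (residueSeries P Q Q 1) =
      algebraMap F[X] (RatFunc F) P / algebraMap F[X] (RatFunc F) (derivative Q) := by
  rw [residueSeries, pow_one, pow_one, EuclideanDomain.div_self hQ,
    PowerSeries.coeff_zero_eq_constantCoeff_apply, map_mul, PowerSeries.constantCoeff_inv,
    ← PowerSeries.coeff_zero_eq_constantCoeff_apply,
    ← PowerSeries.coeff_zero_eq_constantCoeff_apply,
    Polynomial.coeff_coe, Polynomial.coeff_coe, mul_coeff_zero, coeff_zero_shift, coeff_zero_shift,
    coeff_zero_diffQuot, map_one, one_mul, div_eq_mul_inv]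

/-- The squarefree decomposition of an irreducible polynomial is trivial. -/
lemma IsSquarefreeDecomposition.eq_of_irreducible {Q : F[X]} (hQ : Irreducible Q) {m : ℕ}
    {q : ℕ → F[X]} (h : IsSquarefreeDecomposition Q m q) : m = 1 ∧ q 1 = Q := by
  have hm : m ∈ Finset.Icc 1 m := Finset.mem_Icc.2 ⟨h.one_le, le_rfl⟩
  have hu : ¬IsUnit (q m) := fun hu => h.natDegree_pos.ne' (natDegree_eq_zero_of_isUnit hu)
  have hd : q m ^ m ∣ Q := by
    rw [h.prod_eq]
    exact Finset.dvd_prod_of_mem (fun i => q i ^ i) hm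
  have h1 : m = 1 := by
    by_contra hne
    have h2 : q m * q m ∣ Q := by
      rw [← pow_two]
      exact (pow_dvd_pow _ (by have := h.one_le; omega)).trans hd
    exact hu (hQ.squarefree _ h2)
  refine ⟨h1, ?_⟩
  have := h.prod_eq
  rw [h1] at this
  simpa using this.symm

lemma IsSquarefreeDecomposition.of_irreducible {Q : F[X]} (hQ : Irreducible Q) :
    IsSquarefreeDecomposition Q 1 fun _ => Q where
  one_le := le_rfl
  prod_eq := by simp
  squarefree _ _ := hQ.squarefree
  coprime i hi j hj hij := by simp at hi hj; omega
  natDegree_pos := hQ.natDegree_pos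

lemma exists_isAlgebraicResidues [CharZero F] (P : F[X]) {Q : F[X]} (hQ : Irreducible Q) :
    ∃ R, IsAlgebraicResidues P Q R := by
  set x := algebraMap F[X] (RatFunc F) P / algebraMap F[X] (RatFunc F) (derivative Q) with hx
  refine ⟨residueResultant x.num x.denom Q, 1, fun _ => Q,
    fun _ => residueResultant x.num x.denom Q,
    .of_irreducible hQ, ?_, by simp⟩
  intro i hi
  obtain rfl : i = 1 := by simpa using hi
  refine Or.inr ⟨hQ.natDegree_pos.ne', x.num, x.denom, x.denom_ne_zero, x.isCoprime_num_denom, ?_,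
    rfl⟩
  rw [Nat.sub_self, coeff_zero_residueSeries _ hQ.ne_zero, RatFunc.num_div_denom]

/-- A resultant with a split polynomial is a product of values at its roots; `u` collects the signs
and the powers of the leading coefficient. -/
lemma map_residueResultant {E ι : Type*} [Field E] [Fintype ι] (θ : F →+* E) (a b : F[X])
    {q : F[X]} {l : E} (hl : l ≠ 0) {Y : ι → E} (hq : q.map θ = C l * ∏ i, (X - C (Y i))) :
    ∃ u : E, u ≠ 0 ∧ (residueResultant a b q).map θ =
      C u * ∏ i, (C ((a.map θ).eval (Y i)) - X * C ((b.map θ).eval (Y i))) := by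
  classical
  have hdeg : q.natDegree = (∏ i : ι, (X - C (C (Y i))) : E[X][X]).natDegree := by
    rw [← natDegree_map θ, hq, natDegree_C_mul hl,
      natDegree_prod_of_monic _ _ fun i _ => monic_X_sub_C _,
      natDegree_prod_of_monic _ _ fun i _ => monic_X_sub_C _]
    simp
  set f : F[X][X] := a.map C - C X * b.map C with hf
  have hfm : f.map (mapRingHom θ) = (a.map θ).map C - C X * (b.map θ).map C := by
    simp [hf, Polynomial.map_map]
    have : (mapRingHom θ).comp C = C.comp θ := by ext; simp
    rw [this]
  have hqm : (q.map C).map (mapRingHom θ) = C (C l) * ∏ i, (X - C (C (Y i))) := by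
    have : (mapRingHom θ).comp C = C.comp θ := by ext; simp
    rw [Polynomial.map_map, this, ← Polynomial.map_map, hq]
    simp [Polynomial.map_prod]
  have hm : (f.map (mapRingHom θ)).natDegree ≤ f.natDegree := natDegree_map_le
  have h1 : (residueResultant a b q).map θ = C l ^ f.natDegree *
      ∏ i : ι, (f.map (mapRingHom θ)).resultant (X - C (C (Y i))) f.natDegree := by
    rw [← coe_mapRingHom, residueResultant, ← resultant_map_map, hqm,
      natDegree_map_eq_of_injective C_injective,
      resultant_C_mul_right, hdeg, resultant_prod_right _ _ _ _ hm (by simp)]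
  refine ⟨l ^ f.natDegree * ((-1) ^ f.natDegree) ^ Fintype.card ι, by simp [hl], ?_⟩
  rw [h1]
  have h2 : ∀ i : ι, (f.map (mapRingHom θ)).resultant (X - C (C (Y i))) f.natDegree =
      C ((-1) ^ f.natDegree) * (C ((a.map θ).eval (Y i)) - X * C ((b.map θ).eval (Y i))) := by
    intro i
    rw [natDegree_X_sub_C, resultant_X_sub_C_right _ _ _ hm, hfm]
    simp [eval_map]
  simp_rw [h2]
  rw [Finset.prod_mul_distrib, Finset.prod_const, ← mul_assoc, Finset.card_univ]
  simp

/-- For an irreducible denominator, `AlgebraicResidues` computes the polynomial whose roots are the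
residues. -/
theorem IsAlgebraicResidues.map_eq {E ι : Type*} [Field E] [Fintype ι] (θ : F →+* E)
    {P Q R : F[X]} (hQ : Irreducible Q) (h : IsAlgebraicResidues P Q R) {l : E} (hl : l ≠ 0)
    {Y : ι → E} (hY : Function.Injective Y) (hq : Q.map θ = C l * ∏ i, (X - C (Y i))) :
    ∃ u : E, u ≠ 0 ∧ R.map θ = C u *
      ∏ i, (X - C ((P.map θ).eval (Y i) / (derivative (Q.map θ)).eval (Y i))) := by
  classical
  obtain ⟨m, q, r, hd, hr, rfl⟩ := h
  obtain ⟨rfl, rfl⟩ := hd.eq_of_irreducible hQ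
  rw [Finset.Icc_self, Finset.prod_singleton]
  obtain ⟨h0, -⟩ | ⟨-, a, b, hb, hab, hc, hr⟩ := hr 1 (by simp)
  · exact absurd h0 hQ.natDegree_pos.ne'
  have hder : ∀ i, (derivative ((q 1).map θ)).eval (Y i) ≠ 0 := by
    intro i
    rw [hq]
    exact eval_derivative_C_mul_prod_ne_zero hl hY i
  rcases isEmpty_or_nonempty ι with hι | ⟨⟨i₀⟩⟩
  · have := congrArg natDegree hq
    simp at this
    exact absurd this hQ.natDegree_pos.ne'
  have hd0 : derivative (q 1) ≠ 0 := by
    intro h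
    apply hder i₀
    rw [derivative_map, h]
    simp
  rw [Nat.sub_self, coeff_zero_residueSeries _ hQ.ne_zero, div_eq_div_iff
    ((map_ne_zero_iff _ (IsFractionRing.injective _ _)).2 hd0)
    ((map_ne_zero_iff _ (IsFractionRing.injective _ _)).2 hb), ← map_mul, ← map_mul] at hc
  have hc := IsFractionRing.injective _ _ hc
  -- Since `a/b = P/Q'` with `a, b` coprime, `b` divides `Q'`; as the roots of `Q` are simple, `b`
  -- vanishes at none of them.
  have hbd : b ∣ derivative (q 1) := hab.symm.dvd_of_dvd_mul_left ⟨P, by rw [← hc, mul_comm]⟩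
  obtain ⟨w, hw⟩ := hbd
  have hbY : ∀ i, (b.map θ).eval (Y i) ≠ 0 := by
    intro i h
    apply hder i
    rw [derivative_map, hw, Polynomial.map_mul, eval_mul, h, zero_mul]
  obtain ⟨u, hu, hres⟩ := map_residueResultant θ a b hl hq
  refine ⟨u * ∏ i, -(b.map θ).eval (Y i), mul_ne_zero hu
    (Finset.prod_ne_zero_iff.2 fun i _ => neg_ne_zero.2 (hbY i)), ?_⟩
  rw [hr, hres, C_mul, mul_assoc, map_prod, ← Finset.prod_mul_distrib]
  congr 1
  refine Finset.prod_congr rfl fun i _ => ?_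
  have hfrac : (P.map θ).eval (Y i) / (derivative ((q 1).map θ)).eval (Y i) =
      (a.map θ).eval (Y i) / (b.map θ).eval (Y i) := by
    rw [div_eq_div_iff (hder i) (hbY i), derivative_map, ← eval_mul, ← eval_mul,
      ← Polynomial.map_mul, ← Polynomial.map_mul, hc]
  have hab' : C ((b.map θ).eval (Y i)) * C ((a.map θ).eval (Y i) / (b.map θ).eval (Y i)) =
      C ((a.map θ).eval (Y i)) := by
    rw [← C_mul, mul_div_cancel₀ _ (hbY i)]
  rw [hfrac, C_neg]
  linear_combination -hab'

end Residues

/-! ### Irreducibility from permutations of the roots -/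

section Symmetry

open Finset

variable {K E ι : Type*} [Field K] [Field E] [Fintype ι]

lemma eq_zero_of_eval_eq_zero {z : ι → E} (hz : Function.Injective z) {p : E[X]}
    (hp : p.degree < Fintype.card ι) (h : ∀ i, p.eval (z i) = 0) : p = 0 :=
  Polynomial.eq_zero_of_degree_lt_of_eval_index_eq_zero univ hz.injOn
    (by rwa [card_univ]) fun i _ => h i

/-- A polynomial with distinct roots that are permuted transitively is irreducible. -/
lemma irreducible_of_transitive [Nonempty ι] (θ : K →+* E) {f : K[X]} {a : E} (ha : a ≠ 0)
    {z : ι → E} (hz : Function.Injective z) (hf : f.map θ = C a * ∏ i, (X - C (z i)))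
    (htr : ∀ i j, ∃ τ : E →+* E, τ.comp θ = θ ∧ τ (z i) = z j) : Irreducible f := by
  have hdeg : f.natDegree = Fintype.card ι := by
    rw [← natDegree_map θ, hf, natDegree_C_mul ha,
      natDegree_prod_of_monic _ _ fun i _ => monic_X_sub_C _]
    simp
  have hf0 : f ≠ 0 := by
    rintro rfl
    rw [natDegree_zero] at hdeg
    exact Fintype.card_ne_zero hdeg.symm
  -- A factor that vanishes at all the roots takes up the whole degree, so its cofactor is constant.
  have huniv : ∀ g h : K[X], f = g * h → (∀ i, (g.map θ).eval (z i) = 0) → IsUnit h := by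
    intro g h hgh hroot
    have hg0 : g ≠ 0 := by rintro rfl; simp [hf0] at hgh
    have hh0 : h ≠ 0 := by rintro rfl; simp [hf0] at hgh
    have h1 : Fintype.card ι ≤ g.natDegree := by
      by_contra hlt
      push Not at hlt
      apply hg0
      rw [← Polynomial.map_eq_zero θ]
      refine eq_zero_of_eval_eq_zero hz ?_ hroot
      rw [degree_map, degree_eq_natDegree hg0]
      exact_mod_cast hlt
    have h2 := congrArg natDegree hgh
    rw [natDegree_mul hg0 hh0, hdeg] at h2
    rw [isUnit_iff_degree_eq_zero, degree_eq_natDegree hh0]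
    norm_cast
    omega
  refine ⟨fun hu => ?_, fun g h hgh => ?_⟩
  · have := natDegree_eq_zero_of_isUnit hu
    rw [hdeg] at this
    exact Fintype.card_ne_zero this
  by_cases hall : ∀ i, (g.map θ).eval (z i) = 0
  · exact Or.inr (huniv g h hgh hall)
  push Not at hall
  obtain ⟨i, hi⟩ := hall
  -- `g` misses the root `z i`, so by transitivity it misses every root, and `h` vanishes at all of
  -- them.
  refine Or.inl (huniv h g (by rw [hgh, mul_comm]) fun j => ?_)
  have hprod : (g.map θ).eval (z j) * (h.map θ).eval (z j) = 0 := by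
    rw [← eval_mul, ← Polynomial.map_mul, ← hgh, hf, eval_mul, eval_prod,
      prod_eq_zero (mem_univ j) (by simp), mul_zero]
  refine (mul_eq_zero.1 hprod).resolve_left fun hj => hi ?_
  obtain ⟨τ, hτ, hτz⟩ := htr j i
  rw [← hτz, ← hτ, ← Polynomial.map_map, eval_map_apply, hj, map_zero]

omit [Fintype ι] in
/-- If all permutations of the `r i` are induced by field endomorphisms, then distinct sums of the
same number of the `r i` are different unless all the `r i` are equal. -/
lemma sum_injective_of_symmetric [CharZero E] {r : ι → E}
    (hτ : ∀ σ : Equiv.Perm ι, ∃ τ : E →+* E, ∀ i, τ (r i) = r (σ i))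
    (hne : ∃ i j, r i ≠ r j) {I J : Finset ι} (hcard : I.card = J.card)
    (h : ∑ i ∈ I, r i = ∑ i ∈ J, r i) : I = J := by
  classical
  by_contra hIJ
  obtain ⟨i, hiI, hiJ⟩ : ∃ i ∈ I, i ∉ J := by
    by_contra hc
    push Not at hc
    exact hIJ (eq_of_subset_of_card_le hc hcard.ge)
  obtain ⟨j, hjJ, hjI⟩ : ∃ j ∈ J, j ∉ I := by
    by_contra hc
    push Not at hc
    exact hIJ (eq_of_subset_of_card_le hc hcard.le).symm
  -- With `i ∈ I \ J` and `j ∈ J \ I`, swapping them changes the two equal sums by opposite amounts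
  -- `±(r j - r i)`, whence `2 (r i - r j) = 0`.
  have hij : r i = r j := by
    obtain ⟨τ, hτ⟩ := hτ (Equiv.swap i j)
    have h2 := congrArg τ h
    rw [map_sum, map_sum] at h2
    simp_rw [hτ] at h2
    have hI : ∑ x ∈ I, r (Equiv.swap i j x) = ∑ x ∈ I, r x - r i + r j := by
      rw [← add_sum_erase I _ hiI, ← add_sum_erase I r hiI, Equiv.swap_apply_left]
      have : ∑ x ∈ I.erase i, r (Equiv.swap i j x) = ∑ x ∈ I.erase i, r x := by
        refine sum_congr rfl fun x hx => ?_
        rw [Equiv.swap_apply_of_ne_of_ne (ne_of_mem_erase hx)]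
        rintro rfl
        exact hjI (mem_of_mem_erase hx)
      rw [this]; ring
    have hJ : ∑ x ∈ J, r (Equiv.swap i j x) = ∑ x ∈ J, r x - r j + r i := by
      rw [← add_sum_erase J _ hjJ, ← add_sum_erase J r hjJ, Equiv.swap_apply_right]
      have : ∑ x ∈ J.erase j, r (Equiv.swap i j x) = ∑ x ∈ J.erase j, r x := by
        refine sum_congr rfl fun x hx => ?_
        rw [Equiv.swap_apply_of_ne_of_ne _ (ne_of_mem_erase hx)]
        rintro rfl
        exact hiJ (mem_of_mem_erase hx)
      rw [this]; ring
    rw [hI, hJ, h] at h2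
    have : (2 : E) * (r i - r j) = 0 := by linear_combination -h2
    simpa [sub_eq_zero] using this
  -- Swapping `j` with any `x ≠ i` fixes `r i`, so it turns `r i = r j` into `r i = r x`.
  have hall : ∀ x, r x = r i := by
    intro x
    by_cases hxi : x = i
    · rw [hxi]
    obtain ⟨τ, hτ⟩ := hτ (Equiv.swap j x)
    have h2 := congrArg τ hij
    rw [hτ, hτ, Equiv.swap_apply_left, Equiv.swap_apply_of_ne_of_ne _ (Ne.symm hxi)] at h2
    · exact h2.symm
    · rintro rfl
      exact hjI hiI
  obtain ⟨x, y, hxy⟩ := hne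
  exact hxy ((hall x).trans (hall y).symm)

lemma exists_perm_image_eq [DecidableEq ι] {I J : Finset ι} (h : I.card = J.card) :
    ∃ σ : Equiv.Perm ι, I.image σ = J := by
  let e : {x // x ∈ I} ≃ {x // x ∈ J} := Finset.equivOfCardEq h
  refine ⟨e.extendSubtype, eq_of_subset_of_card_le ?_ ?_⟩
  · intro y hy
    obtain ⟨x, hx, rfl⟩ := mem_image.1 hy
    exact e.extendSubtype_mem x hx
  · rw [card_image_of_injective _ (Equiv.injective _), h]

/-- A polynomial whose roots can be permuted arbitrarily by automorphisms over the base field. -/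
def HasSymmetricRoots (θ : K →+* E) (Q : K[X]) (l : E) (Y : ι → E) : Prop :=
  l ≠ 0 ∧ Function.Injective Y ∧ Q.map θ = C l * ∏ i, (X - C (Y i)) ∧
    ∀ σ : Equiv.Perm ι, ∃ τ : E →+* E, τ.comp θ = θ ∧ ∀ i, τ (Y i) = Y (σ i)

variable {θ : K →+* E} {Q : K[X]} {l : E} {Y : ι → E}

lemma HasSymmetricRoots.irreducible [Nonempty ι] (h : HasSymmetricRoots θ Q l Y) :
    Irreducible Q := by
  classical
  refine irreducible_of_transitive θ h.1 h.2.1 h.2.2.1 fun i j => ?_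
  obtain ⟨τ, h1, h2⟩ := h.2.2.2 (Equiv.swap i j)
  exact ⟨τ, h1, by rw [h2, Equiv.swap_apply_left]⟩

/-- The residues are values of one rational function over `K` at the roots, so they inherit every
permutation of the roots; permutations act transitively on `c`-subsets. -/
theorem HasSymmetricRoots.irreducible_pureComposedSum [CharZero K] [CharZero E]
    (h : HasSymmetricRoots θ Q l Y) {P R : K[X]} (hP : P ≠ 0)
    (hPdeg : P.natDegree + 2 ≤ Fintype.card ι) (hR : IsAlgebraicResidues P Q R) {c : ℕ}
    (hc : 0 < c) (hc' : c < Fintype.card ι) :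
    Irreducible (pureComposedSum R c) ∧
      (pureComposedSum R c).natDegree = (Fintype.card ι).choose c := by
  classical
  have hne : Nonempty ι := Fintype.card_pos_iff.1 (by omega)
  have hirr := h.irreducible
  obtain ⟨hl, hY, hQ, hsymm⟩ := h
  obtain ⟨u, hu, hRm⟩ := hR.map_eq θ hirr hl hY hQ
  set r : ι → E := fun i => (P.map θ).eval (Y i) / (derivative (Q.map θ)).eval (Y i) with hr
  have hsymm' : ∀ σ : Equiv.Perm ι, ∃ τ : E →+* E, τ.comp θ = θ ∧ ∀ i, τ (r i) = r (σ i) := by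
    intro σ
    obtain ⟨τ, h1, h2⟩ := hsymm σ
    refine ⟨τ, h1, fun i => ?_⟩
    have hev : ∀ p : K[X], τ ((p.map θ).eval (Y i)) = (p.map θ).eval (Y (σ i)) := fun p => by
      rw [← eval_map_apply, Polynomial.map_map, h1, h2]
    simp only [hr, derivative_map]
    rw [map_div₀, hev, hev]
  have hmapdeg : (P.map θ).degree < ((Fintype.card ι : ℕ) : WithBot ℕ) := by
    rw [degree_map, degree_eq_natDegree hP]
    exact_mod_cast (by omega : P.natDegree < Fintype.card ι)
  have hne' : ∃ i j, r i ≠ r j := by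
    by_contra hall
    push Not at hall
    -- The sum of the residues is read off the coefficient of degree `n - 1` of `P`, which is zero
    -- by the degree bound.
    have hsum : ∑ i, r i = 0 := by
      simp only [hr, hQ]
      rw [sum_eval_div_eval_derivative hY hmapdeg, coeff_map, coeff_eq_zero_of_natDegree_lt,
        map_zero, zero_div]
      omega
    have hr0 : ∀ i, r i = 0 := by
      intro i
      rw [sum_congr rfl fun j _ => hall j i, sum_const, card_univ, nsmul_eq_mul] at hsum
      exact (mul_eq_zero.1 hsum).resolve_left (Nat.cast_ne_zero.2 (by omega))
    apply hP
    rw [← Polynomial.map_eq_zero θ]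
    refine eq_zero_of_eval_eq_zero hY hmapdeg fun i => ?_
    have := hr0 i
    simp only [hr, hQ] at this
    exact (div_eq_zero_iff.1 this).resolve_right (eval_derivative_C_mul_prod_ne_zero hl hY i)
  have hinj : ∀ I J : Finset ι, I.card = J.card → ∑ i ∈ I, r i = ∑ i ∈ J, r i → I = J :=
    fun I J => sum_injective_of_symmetric (fun σ => (hsymm' σ).imp fun _ h => h.2) hne'
  have htrans : ∀ I J : Finset ι, I.card = J.card → ∃ τ : E →+* E, τ.comp θ = θ ∧
      τ (∑ i ∈ I, r i) = ∑ i ∈ J, r i := by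
    intro I J hIJ
    obtain ⟨σ, rfl⟩ := exists_perm_image_eq hIJ
    obtain ⟨τ, h1, h2⟩ := hsymm' σ
    refine ⟨τ, h1, ?_⟩
    rw [map_sum, sum_image (fun _ _ _ _ h => σ.injective h)]
    exact sum_congr rfl fun i _ => h2 i
  have hcard : #(powersetCard c (univ : Finset ι)) = (Fintype.card ι).choose c := by
    rw [card_powersetCard, card_univ]
  have hne0 : ∀ I ∈ powersetCard c (univ : Finset ι), ∑ i ∈ I, r i ≠ 0 := by
    intro I hI h0
    -- If one sum were zero, transitivity would make all of them zero; having at least two subsets,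
    -- this contradicts their distinctness.
    have h1 : 1 < #(powersetCard c (univ : Finset ι)) := by
      rw [hcard]
      obtain ⟨n, hn⟩ := Nat.exists_eq_add_of_lt hc'
      obtain ⟨c, rfl⟩ := Nat.exists_eq_succ_of_ne_zero hc.ne'
      rw [hn, Nat.succ_eq_add_one, Nat.choose_succ_succ']
      have h2 := Nat.choose_pos (show c ≤ c + 1 + n by omega)
      have h3 := Nat.choose_pos (show c + 1 ≤ c + 1 + n by omega)
      omega
    obtain ⟨J, hJ, hJI⟩ := exists_mem_ne h1 I
    have hIJ : I.card = J.card := by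
      rw [(mem_powersetCard.1 hI).2, (mem_powersetCard.1 hJ).2]
    obtain ⟨τ, -, h3⟩ := htrans I J hIJ
    rw [h0, map_zero] at h3
    exact hJI (hinj I J hIJ (h0.trans h3)).symm
  have hmap := map_pureComposedSum_of_ne_zero θ hu hRm c hne0
  refine ⟨?_, ?_⟩
  · have : Nonempty (powersetCard c (univ : Finset ι)) := by
      rw [nonempty_coe_sort, powersetCard_nonempty, card_univ]
      exact hc'.le
    refine irreducible_of_transitive θ one_ne_zero
      (z := fun I : powersetCard c (univ : Finset ι) => ∑ i ∈ I.1, r i) ?_ ?_ ?_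
    · intro I J hIJ
      refine Subtype.ext (hinj _ _ ?_ hIJ)
      rw [(mem_powersetCard.1 I.2).2, (mem_powersetCard.1 J.2).2]
    · rw [hmap, C_1, one_mul, ← Finset.prod_coe_sort]
    · intro I J
      refine htrans _ _ ?_
      rw [(mem_powersetCard.1 I.2).2, (mem_powersetCard.1 J.2).2]
  · rw [← natDegree_map θ, hmap, natDegree_prod_of_monic _ _ fun i _ => monic_X_sub_C _]
    simp only [natDegree_X_sub_C, sum_const, smul_eq_mul, mul_one]
    rw [hcard]

end Symmetry

/-! ### The generic denominator has independent roots -/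

section Generic

variable (dx dy : ℕ)

/-- The indeterminate `b_{i,j}`. -/
def genericCoeff (p : Fin (dx + 1) × Fin (dy + 1)) : GenericField dx dy :=
  algebraMap (MvPolynomial (Fin (dx + 1) × Fin (dy + 1)) ℚ) (GenericField dx dy) (MvPolynomial.X p)

/-- `y^{dx} B(t / y, y)`. -/
def genericQ : (GenericField dx dy)[X][X] :=
  ∑ i : Fin (dx + 1), ∑ j : Fin (dy + 1),
    C (C (genericCoeff dx dy (i, j)) * X ^ (i : ℕ)) * X ^ ((j : ℕ) + dx - i)

lemma genericCoeff_ne_zero (p : Fin (dx + 1) × Fin (dy + 1)) : genericCoeff dx dy p ≠ 0 :=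
  (map_ne_zero_iff _ (IsFractionRing.injective _ _)).2 (MvPolynomial.X_ne_zero p)

lemma natDegree_genericQ_le : (genericQ dx dy).natDegree ≤ dx + dy := by
  refine natDegree_sum_le_of_forall_le _ _ fun i _ =>
    natDegree_sum_le_of_forall_le _ _ fun j _ => ?_
  refine (natDegree_C_mul_X_pow_le _ _).trans ?_
  omega

lemma coeff_genericQ_top :
    (genericQ dx dy).coeff (dx + dy) = C (genericCoeff dx dy (0, Fin.last dy)) := by
  simp only [genericQ, finsetSum_coeff, coeff_C_mul_X_pow]
  rw [Finset.sum_eq_single 0, Finset.sum_eq_single (Fin.last dy)]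
  · rw [if_pos (by simp [add_comm])]; simp
  · intro j _ hj
    rw [if_neg]
    intro h
    apply hj
    ext
    simp at h ⊢
    omega
  · simp
  · intro i _ hi
    refine Finset.sum_eq_zero fun j _ => if_neg fun h => hi ?_
    ext
    have := j.2
    rw [Fin.val_zero]
    omega
  · simp

lemma natDegree_genericQ : (genericQ dx dy).natDegree = dx + dy := by
  refine le_antisymm (natDegree_genericQ_le dx dy) (le_natDegree_of_ne_zero ?_)
  rw [coeff_genericQ_top]
  exact C_ne_zero.2 (genericCoeff_ne_zero _ _ _)

lemma leadingCoeff_genericQ :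
    (genericQ dx dy).leadingCoeff = C (genericCoeff dx dy (0, Fin.last dy)) := by
  rw [leadingCoeff, natDegree_genericQ, coeff_genericQ_top]

/-- On the hook `i = 0` or `j = 0` the exponent `j + dx - i` takes each value from `0` to `dx + dy`
exactly once. Adjusting only these `b_{i,j}` thus prescribes every coefficient of `genericQ`. -/
lemma sum_hook {G : Type*} [AddCommMonoid G] (f : ℕ → G) :
    ∑ i : Fin (dx + 1), ∑ j : Fin (dy + 1), (if i = 0 ∨ j = 0 then f (j + dx - i) else 0) =
      ∑ m ∈ Finset.range (dx + dy + 1), f m := by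
  rw [Fin.sum_univ_succ]
  have h1 : ∑ j : Fin (dy + 1), (if (0 : Fin (dx + 1)) = 0 ∨ j = 0 then
      f (j + dx - ((0 : Fin (dx + 1)) : ℕ)) else 0) = ∑ j ∈ Finset.range (dy + 1), f (dx + j) := by
    rw [← Fin.sum_univ_eq_sum_range (fun j => f (dx + j))]
    simp [add_comm]
  have h2 : ∀ i : Fin dx, ∑ j : Fin (dy + 1), (if i.succ = 0 ∨ j = 0 then
      f (j + dx - (i.succ : ℕ)) else 0) = f (dx - 1 - i) := by
    intro i
    rw [Finset.sum_eq_single 0]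
    · simp [Nat.sub_sub, add_comm]
    · intro j _ hj
      simp [hj]
    · simp
  rw [h1, Finset.sum_congr rfl fun i _ => h2 i, Fin.sum_univ_eq_sum_range (fun i => f (dx - 1 - i)),
    Finset.sum_range_reflect, add_comm, add_assoc dx dy 1, Finset.sum_range_add f]

lemma exists_eq_C_mul_prod {L : Type*} [Field L] {f : L[X]} (hf : f.Splits) {n : ℕ}
    (hn : f.natDegree = n) : ∃ y : Fin n → L, f = C f.leadingCoeff * ∏ i, (X - C (y i)) := by
  have hcard : f.roots.toList.length = n := by
    rw [Multiset.length_toList, ← hf.natDegree_eq_card_roots, hn]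
  subst hcard
  refine ⟨f.roots.toList.get, ?_⟩
  conv_lhs => rw [hf.eq_prod_roots]
  congr 1
  conv_lhs => rw [← Multiset.coe_toList f.roots]
  rw [Multiset.map_coe, Multiset.prod_coe, ← List.prod_ofFn]
  congr 1
  apply List.ext_get <;> simp

local notation "𝔹" => MvPolynomial (Fin (dx + 1) × Fin (dy + 1)) ℚ

local notation "𝕜" => GenericField dx dy

local notation "𝕂" => RatFunc (GenericField dx dy)

local notation "𝕂bar" => AlgebraicClosure (RatFunc (GenericField dx dy))

local notation "𝕊" => MvPolynomial (Fin (dx + dy)) (RatFunc (GenericField dx dy))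

/-- Over a suitable extension of `k(t)` the roots of the generic denominator are independent
indeterminates, so that they can be permuted arbitrarily. -/
theorem exists_hasSymmetricRoots (E : Type*) [Field E]
    [Algebra 𝕊 E] [IsFractionRing 𝕊 E] :
    ∃ (θ : 𝕂 →+* E) (l : E) (Y : Fin (dx + dy) → E),
      HasSymmetricRoots θ (overRatFunc (genericQ dx dy)) l Y := by
  let Q : 𝕂[X] := overRatFunc (genericQ dx dy)
  let b : Fin (dx + 1) × Fin (dy + 1) → 𝕂 := fun p => algebraMap 𝕜[X] 𝕂 (C (genericCoeff dx dy p))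
  have hQsum : Q = ∑ i : Fin (dx + 1), ∑ j : Fin (dy + 1),
      C (b (i, j) * RatFunc.X ^ (i : ℕ)) * X ^ ((j : ℕ) + dx - i) := by
    simp only [Q, overRatFunc, genericQ, Polynomial.map_sum, Polynomial.map_mul, map_C,
      Polynomial.map_pow, map_X, map_mul, map_pow, RatFunc.algebraMap_X, b]
  have hinjK : Function.Injective (algebraMap 𝕜[X] 𝕂) := IsFractionRing.injective _ _
  have hQdeg : Q.natDegree = (dx + dy) := by
    simp only [Q, overRatFunc]
    rw [natDegree_map_eq_of_injective hinjK, natDegree_genericQ]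
  have hQlead : Q.leadingCoeff = b (0, Fin.last dy) := by
    simp only [Q, overRatFunc]
    rw [leadingCoeff_map_of_injective hinjK, leadingCoeff_genericQ]
  have hb0 : ∀ p, b p ≠ 0 := fun p =>
    (map_ne_zero_iff _ hinjK).2 (C_ne_zero.2 (genericCoeff_ne_zero _ _ _))
  obtain ⟨y, hy⟩ := exists_eq_C_mul_prod (IsAlgClosed.splits (Q.map (algebraMap 𝕂 𝕂bar)))
    ((natDegree_map _).trans hQdeg)
  rw [leadingCoeff_map, hQlead] at hy
  -- `T` has indeterminate roots and the leading coefficient of `Q`. The `β p` are the `b p`,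
  -- corrected along the hook so that `genericQ` with coefficients `β` becomes `T`.
  let T : 𝕊[X] := C (MvPolynomial.C (b (0, Fin.last dy))) * ∏ i, (X - C (MvPolynomial.X i))
  let δ : ℕ → 𝕊 := fun m => (T - Q.map MvPolynomial.C).coeff m
  let β : Fin (dx + 1) × Fin (dy + 1) → 𝕊 := fun p => MvPolynomial.C (b p) +
    if p.1 = 0 ∨ p.2 = 0 then
      MvPolynomial.C (RatFunc.X ^ (p.1 : ℕ))⁻¹ * δ ((p.2 : ℕ) + dx - p.1) else 0
  have ht0 : (RatFunc.X : 𝕂) ≠ 0 := RatFunc.X_ne_zero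
  have hTdeg : T.natDegree ≤ (dx + dy) := by
    refine (natDegree_C_mul_le _ _).trans ?_
    rw [natDegree_prod_of_monic _ _ fun i _ => monic_X_sub_C _]
    simp
  have hβ : ∑ i : Fin (dx + 1), ∑ j : Fin (dy + 1),
      C (β (i, j) * MvPolynomial.C RatFunc.X ^ (i : ℕ)) * X ^ ((j : ℕ) + dx - i) = T := by
    have h1 : ∀ i j, C (β (i, j) * MvPolynomial.C RatFunc.X ^ (i : ℕ)) *
        X ^ ((j : ℕ) + dx - i) = C (MvPolynomial.C (b (i, j) * RatFunc.X ^ (i : ℕ))) *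
          X ^ ((j : ℕ) + dx - i) + if i = 0 ∨ j = 0 then
            C (δ ((j : ℕ) + dx - i)) * X ^ ((j : ℕ) + dx - i) else 0 := by
      intro i j
      have h2 : MvPolynomial.C (RatFunc.X ^ (i : ℕ))⁻¹ * (MvPolynomial.C RatFunc.X ^ (i : ℕ) : 𝕊)
          = 1 := by
        rw [← map_pow, ← map_mul, inv_mul_cancel₀ (pow_ne_zero _ ht0), map_one]
      simp only [β]
      rw [add_mul, C_add, add_mul, map_mul (MvPolynomial.C), map_pow]
      congr 1
      split_ifs
      · rw [mul_right_comm, h2, one_mul]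
      · simp
    simp_rw [h1, Finset.sum_add_distrib]
    rw [sum_hook dx dy fun m => C (δ m) * X ^ m]
    have h3 : ∑ m ∈ Finset.range (dx + dy + 1), C (δ m) * X ^ m = T - Q.map MvPolynomial.C := by
      rw [eq_comm]
      apply as_sum_range_C_mul_X_pow'
      refine Nat.lt_succ_of_le ((natDegree_sub_le _ _).trans (max_le hTdeg ?_))
      exact natDegree_map_le.trans hQdeg.le
    rw [h3]
    have h4 : Q.map (MvPolynomial.C (σ := Fin (dx + dy))) = ∑ i : Fin (dx + 1), ∑ j : Fin (dy + 1),
        C (MvPolynomial.C (b (i, j) * RatFunc.X ^ (i : ℕ))) * X ^ ((j : ℕ) + dx - i) := by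
      simp only [hQsum, Polynomial.map_sum, Polynomial.map_mul, map_C, Polynomial.map_pow, map_X]
    rw [← h4]
    ring
  -- specializing the indeterminates to the actual roots
  let spec : 𝕊 →+* 𝕂bar := MvPolynomial.eval₂Hom (algebraMap 𝕂 𝕂bar) y
  have hspecC : ∀ a, spec (MvPolynomial.C a) = algebraMap 𝕂 𝕂bar a := fun a => by simp [spec]
  have hspecδ : ∀ m, spec (δ m) = 0 := by
    intro m
    have : (T - Q.map MvPolynomial.C).map spec = 0 := by
      have hcomp : spec.comp MvPolynomial.C = algebraMap 𝕂 𝕂bar := RingHom.ext hspecC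
      rw [Polynomial.map_sub, Polynomial.map_map, hcomp, hy, sub_eq_zero]
      simp only [T, Polynomial.map_mul, map_C, Polynomial.map_prod, Polynomial.map_sub, map_X,
        hspecC]
      simp [spec]
    simp only [δ]
    rw [← coeff_map, this, coeff_zero]
  have hspecβ : ∀ p, spec (β p) = algebraMap 𝕂 𝕂bar (b p) := by
    intro p
    simp only [β]
    split_ifs <;> simp [hspecC, hspecδ]
  let θ₀ : 𝔹 →+* 𝕊 := MvPolynomial.eval₂Hom (algebraMap ℚ 𝕊) β
  let θ₁ : 𝔹[X] →+* 𝕊 := eval₂RingHom θ₀ (MvPolynomial.C RatFunc.X)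
  -- At the true roots the corrections vanish and `β` becomes `b`, so `spec ∘ θ₁` is the canonical
  -- embedding. Hence `θ₁` is injective: the corrected coefficients are still algebraically
  -- independent, jointly with `t`.
  have hθ₁ : spec.comp θ₁ = (algebraMap 𝕂 𝕂bar).comp ((algebraMap 𝕜[X] 𝕂).comp
      (mapRingHom (algebraMap 𝔹 𝕜))) := by
    refine Polynomial.ringHom_ext'
      (MvPolynomial.ringHom_ext' (Subsingleton.elim _ _) fun p => ?_) ?_
    · simp [θ₁, θ₀, hspecβ, b, genericCoeff]
    · simp [θ₁, hspecC, RatFunc.algebraMap_X]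
  have hθ₁inj : Function.Injective θ₁ := by
    have : Function.Injective (spec.comp θ₁) := by
      rw [hθ₁]
      exact (algebraMap 𝕂 𝕂bar).injective.comp (hinjK.comp
        (Polynomial.map_injective _ (IsFractionRing.injective 𝔹 𝕜)))
    rw [RingHom.coe_comp] at this
    exact this.of_comp
  have hinjE : Function.Injective (algebraMap 𝕊 E) := IsFractionRing.injective _ _
  have hθ₀inj : Function.Injective ((algebraMap 𝕊 E).comp θ₀) := by
    have : θ₀ = θ₁.comp C := by ext <;> simp [θ₁]
    rw [this]
    exact hinjE.comp (hθ₁inj.comp C_injective)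
  let θk : 𝕜 →+* E := IsFractionRing.lift hθ₀inj
  let θt : 𝕜[X] →+* E := eval₂RingHom θk (algebraMap 𝕊 E (MvPolynomial.C RatFunc.X))
  have hθt : θt.comp (mapRingHom (algebraMap 𝔹 𝕜)) = (algebraMap 𝕊 E).comp θ₁ := by
    refine Polynomial.ringHom_ext' (RingHom.ext fun a => ?_) ?_
    · simp [θt, θ₁, θk]
    · simp [θt, θ₁]
  -- Clearing the denominators in the `b_{i,j}` reduces this to the injectivity of `θ₁`.
  have hθtinj : Function.Injective θt := by
    rw [injective_iff_map_eq_zero]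
    intro p hp
    obtain ⟨d, hd0, hd⟩ := IsLocalization.integerNormalization_spec (nonZeroDivisors 𝔹) p
    have h1 : (algebraMap 𝕊 E).comp θ₁ (IsLocalization.integerNormalization (nonZeroDivisors 𝔹) p)
        = 0 := by
      rw [← hθt, RingHom.comp_apply, coe_mapRingHom, hd, Algebra.smul_def, map_mul, hp, mul_zero]
    rw [RingHom.comp_apply, map_eq_zero_iff _ hinjE, map_eq_zero_iff _ hθ₁inj] at h1
    rw [h1, Polynomial.map_zero, eq_comm, smul_eq_zero] at hd
    exact hd.resolve_left (nonZeroDivisors.ne_zero hd0)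
  let θ : 𝕂 →+* E := IsFractionRing.lift hθtinj
  have hθb : ∀ p, θ (b p) = algebraMap 𝕊 E (β p) := by
    intro p
    simp only [θ, b, IsFractionRing.lift_algebraMap]
    simp [θt, θk, genericCoeff, θ₀]
  have hθX : θ RatFunc.X = algebraMap 𝕊 E (MvPolynomial.C RatFunc.X) := by
    rw [← RatFunc.algebraMap_X]
    simp only [θ, IsFractionRing.lift_algebraMap]
    simp [θt]
  refine ⟨θ, algebraMap 𝕊 E (MvPolynomial.C (b (0, Fin.last dy))),
    fun i => algebraMap 𝕊 E (MvPolynomial.X i), ?_, ?_, ?_, ?_⟩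
  · rw [map_ne_zero_iff _ hinjE, Ne, MvPolynomial.C_eq_zero]
    exact hb0 _
  · exact hinjE.comp (MvPolynomial.X_injective)
  · change Q.map θ = _
    have h1 : Q.map θ = T.map (algebraMap 𝕊 E) := by
      rw [← hβ, hQsum]
      simp only [Polynomial.map_sum, Polynomial.map_mul, map_C, Polynomial.map_pow, map_X, map_mul,
        map_pow, hθb, hθX]
    rw [h1]
    simp only [T, Polynomial.map_mul, map_C, Polynomial.map_prod, Polynomial.map_sub, map_X]
  · intro σ
    -- `T` is symmetric in the variables, so renaming them fixes the corrections `δ`, hence all `β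
    -- p` and the image of `θ`.
    let ρ : 𝕊 →+* 𝕊 := (MvPolynomial.rename σ).toRingHom
    have hρX : ∀ i, ρ (MvPolynomial.X i) = MvPolynomial.X (σ i) := fun i => by simp [ρ]
    have hρC : ∀ a, ρ (MvPolynomial.C a) = MvPolynomial.C a := fun a => by simp [ρ]
    have hρinj : Function.Injective ρ := MvPolynomial.rename_injective σ σ.injective
    have hρδ : ∀ m, ρ (δ m) = δ m := by
      intro m
      have hT : T.map ρ = T := by
        simp only [T, Polynomial.map_mul, map_C, Polynomial.map_prod, Polynomial.map_sub, map_X,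
          hρC, hρX]
        rw [Equiv.prod_comp σ fun i => (X - C (MvPolynomial.X i) : 𝕊[X])]
      have hQ : (Q.map MvPolynomial.C).map ρ = Q.map MvPolynomial.C := by
        rw [Polynomial.map_map]
        congr 1
        exact RingHom.ext hρC
      simp only [δ]
      rw [← coeff_map, Polynomial.map_sub, hT, hQ]
    have hρβ : ∀ p, ρ (β p) = β p := by
      intro p
      simp only [β]
      split_ifs <;> simp [hρC, hρδ]
    have hτinj : Function.Injective ((algebraMap 𝕊 E).comp ρ) := hinjE.comp hρinj
    let τ : E →+* E := IsFractionRing.lift hτinj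
    have hτ : ∀ a : 𝕊, τ (algebraMap 𝕊 E a) = algebraMap 𝕊 E (ρ a) := fun a => by
      simp only [τ, IsFractionRing.lift_algebraMap, RingHom.comp_apply]
    refine ⟨τ, ?_, fun i => by rw [hτ, hρX]⟩
    refine IsLocalization.ringHom_ext (nonZeroDivisors 𝕜[X]) ?_
    refine Polynomial.ringHom_ext' (IsLocalization.ringHom_ext (nonZeroDivisors 𝔹)
      (MvPolynomial.ringHom_ext' (Subsingleton.elim _ _) fun p => ?_)) ?_
    · have := hθb p
      simp only [b, genericCoeff] at this
      simp only [RingHom.comp_apply]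
      rw [this, hτ, hρβ]
    · simp only [RingHom.comp_apply]
      rw [RatFunc.algebraMap_X, hθX, hτ, hρC]

end Generic

/-! ### The reduced form of `(1/y) (A/B)(t/y, y)` -/

section ReducedForm

variable {k : Type*} [Field k]

/-- `y^N A(t / y, y)`, for `N` at least the degree of `A` in the first variable. -/
def diagNumer (N : ℕ) (A : MvPolynomial (Fin 2) k) : k[X][X] :=
  ∑ s ∈ A.support, C (C (A.coeff s) * X ^ s 0) * X ^ (s 1 + N - s 0)

lemma pow_mul_pow_mul_pow {T : Type*} [CommRing T] {x y t : T} (h : x * y = t) {i N : ℕ}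
    (hi : i ≤ N) (j : ℕ) : x ^ i * y ^ j * y ^ N = t ^ i * y ^ (j + N - i) := by
  rw [← h, mul_pow, mul_assoc, mul_assoc, ← pow_add, ← pow_add]
  congr 2
  omega

/-- Stated for arbitrary ring maps because it serves both in `k(t, y)`, for the algorithm, and in
`k((y))⟦t⟧`, for the diagonal. -/
lemma map_mul_pow_eq_map_diagNumer {T : Type*} [CommRing T] (Θ : MvPolynomial (Fin 2) k →+* T)
    (Ξ : k[X][X] →+* T) (hC : ∀ a, Ξ (C (C a)) = Θ (MvPolynomial.C a))
    (h0 : Θ (MvPolynomial.X 0) * Ξ X = Ξ (C X)) (h1 : Θ (MvPolynomial.X 1) = Ξ X) {N : ℕ}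
    {A : MvPolynomial (Fin 2) k} (hN : A.degreeOf 0 ≤ N) :
    Θ A * Ξ X ^ N = Ξ (diagNumer N A) := by
  conv_lhs => rw [A.as_sum]
  rw [map_sum, diagNumer, map_sum, Finset.sum_mul]
  refine Finset.sum_congr rfl fun s hs => ?_
  have hs0 : s 0 ≤ N := (MvPolynomial.le_degreeOf_of_mem_support 0 hs).trans hN
  rw [MvPolynomial.monomial_eq, Finsupp.prod_fintype _ _ (by simp), Fin.prod_univ_two, map_mul,
    map_mul, map_pow, map_pow, h1, mul_assoc, pow_mul_pow_mul_pow h0 hs0, map_mul, C_mul, map_mul,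
    hC, C_pow, map_pow, map_pow, mul_assoc]

lemma map_genericB_mul_pow {dx dy : ℕ} {T : Type*} [CommRing T]
    (Θ : MvPolynomial (Fin 2) (GenericField dx dy) →+* T)
    (Ξ : (GenericField dx dy)[X][X] →+* T) (hC : ∀ a, Ξ (C (C a)) = Θ (MvPolynomial.C a))
    (h0 : Θ (MvPolynomial.X 0) * Ξ X = Ξ (C X)) (h1 : Θ (MvPolynomial.X 1) = Ξ X) :
    Θ (genericB dx dy) * Ξ X ^ dx = Ξ (genericQ dx dy) := by
  simp only [genericB, genericQ, map_sum, Finset.sum_mul]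
  refine Finset.sum_congr rfl fun i _ => Finset.sum_congr rfl fun j _ => ?_
  rw [map_mul, map_mul, map_pow, map_pow, h1, mul_assoc (Θ _), mul_assoc (Θ _),
    pow_mul_pow_mul_pow h0 (by omega), map_mul, C_mul, map_mul, hC, C_pow, map_pow, map_pow,
    mul_assoc, genericCoeff]

lemma natDegree_diagNumer_le {N M : ℕ} {A : MvPolynomial (Fin 2) k} (hM : A.degreeOf 1 ≤ M) :
    (diagNumer N A).natDegree ≤ N + M := by
  refine natDegree_sum_le_of_forall_le _ _ fun s hs => ?_
  refine (natDegree_C_mul_X_pow_le _ _).trans ?_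
  have := (MvPolynomial.le_degreeOf_of_mem_support 1 hs).trans hM
  omega

/-- Distinct monomials `x^i y^j` give distinct `t^i y^(j+N-i)`, so nothing cancels. -/
lemma diagNumer_ne_zero {N : ℕ} {A : MvPolynomial (Fin 2) k} (hA : A ≠ 0)
    (hN : A.degreeOf 0 ≤ N) : diagNumer N A ≠ 0 := by
  obtain ⟨s, hs⟩ := MvPolynomial.support_nonempty.2 hA
  intro h
  have h1 := congrArg (fun p => (p.coeff (s 1 + N - s 0)).coeff (s 0)) h
  simp only [diagNumer, finsetSum_coeff, coeff_C_mul_X_pow, coeff_zero] at h1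
  rw [Finset.sum_eq_single s] at h1
  · rw [if_pos rfl, coeff_C_mul_X_pow, if_pos rfl] at h1
    exact MvPolynomial.mem_support_iff.1 hs h1
  · intro s' hs' hne
    split_ifs with h2
    · rw [coeff_C_mul_X_pow, if_neg]
      intro h3
      apply hne
      have := (MvPolynomial.le_degreeOf_of_mem_support 0 hs').trans hN
      ext i
      fin_cases i
      · exact h3.symm
      · simp
        omega
    · simp
  · intro h
    exact absurd hs h

/-- `Q = y^N A(t / y, y)`. -/
def IsDiagLift (N : ℕ) (A : MvPolynomial (Fin 2) k) (Q : k[X][X]) : Prop :=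
  substDiag A * algebraMap k[X][X] (FractionRing k[X][X]) X ^ N =
    algebraMap k[X][X] (FractionRing k[X][X]) Q

lemma algebraMap_X_ne_zero : algebraMap k[X][X] (FractionRing k[X][X]) X ≠ 0 :=
  (map_ne_zero_iff _ (IsFractionRing.injective _ _)).2 X_ne_zero

lemma substDiag_C (a : k) :
    substDiag (MvPolynomial.C a) = algebraMap k[X][X] (FractionRing k[X][X]) (C (C a)) := by
  simp [substDiag, IsScalarTower.algebraMap_apply k k[X][X] (FractionRing k[X][X])]

lemma isDiagLift_diagNumer (A : MvPolynomial (Fin 2) k) {N : ℕ} (hN : A.degreeOf 0 ≤ N) :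
    IsDiagLift N A (diagNumer N A) := by
  refine map_mul_pow_eq_map_diagNumer (MvPolynomial.aeval _ : _ →ₐ[k] _).toRingHom _
    (fun a => (substDiag_C a).symm) ?_ ?_ hN
  · simp
  · simp

lemma isDiagLift_genericQ (dx dy : ℕ) : IsDiagLift dx (genericB dx dy) (genericQ dx dy) := by
  refine map_genericB_mul_pow (MvPolynomial.aeval _ : _ →ₐ[GenericField dx dy] _).toRingHom _
    (fun a => (substDiag_C a).symm) ?_ ?_
  · simp
  · simp

lemma IsDiagLift.one_div_mul_div {N : ℕ} {A B : MvPolynomial (Fin 2) k} {P Q : k[X][X]}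
    (hP : IsDiagLift N A P) (hQ : IsDiagLift (N + 1) B Q) :
    1 / algebraMap k[X][X] (FractionRing k[X][X]) X * (substDiag A / substDiag B) =
      algebraMap k[X][X] (FractionRing k[X][X]) P /
        algebraMap k[X][X] (FractionRing k[X][X]) Q := by
  rw [← hP, ← hQ, pow_succ, div_mul_div_comm, one_mul, mul_comm (substDiag B), mul_assoc,
    mul_comm (substDiag A), mul_div_mul_left _ _ (pow_ne_zero _ algebraMap_X_ne_zero)]

lemma natDegree_overRatFunc (P : k[X][X]) : (overRatFunc P).natDegree = P.natDegree :=
  natDegree_map_eq_of_injective (IsFractionRing.injective _ _) _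

lemma overRatFunc_ne_zero {P : k[X][X]} (hP : P ≠ 0) : overRatFunc P ≠ 0 := by
  rwa [overRatFunc, Ne, Polynomial.map_eq_zero_iff (IsFractionRing.injective _ _)]

/-- A polynomial that is irreducible over `k(t)` and has a constant leading coefficient is prime
to every nonzero polynomial of lower degree. -/
lemma isRelPrime_of_irreducible {P Q : k[X][X]} (hP : P ≠ 0) (hQ : Irreducible (overRatFunc Q))
    (hl : IsUnit Q.leadingCoeff) (hdeg : P.natDegree < Q.natDegree) : IsRelPrime P Q := by
  intro d hdP hdQ
  have hd : overRatFunc d ∣ overRatFunc Q := Polynomial.map_dvd _ hdQ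
  rcases (hQ.dvd_iff).1 hd with hu | ha
  · have h0 := natDegree_eq_zero_of_isUnit hu
    rw [natDegree_overRatFunc] at h0
    obtain ⟨e, rfl⟩ := natDegree_eq_zero.1 h0
    exact (isUnit_of_dvd_unit ((C_dvd_iff_dvd_coeff _ _).1 hdQ _) hl).map C
  · have h0 := natDegree_eq_of_degree_eq (degree_eq_degree_of_associated ha)
    rw [natDegree_overRatFunc, natDegree_overRatFunc] at h0
    have := natDegree_le_of_dvd hdP hP
    omega

variable {dx dy : ℕ} {A : MvPolynomial (Fin 2) (GenericField dx dy)}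

variable (hQ : Irreducible (overRatFunc (genericQ dx dy))) (hA : A ≠ 0)
  (hx : A.degreeOf 0 < dx) (hy : A.degreeOf 1 < dy)

-- The gap of `2` below the degree of `genericQ` is what makes the residues sum to zero.
include hx hy in
lemma natDegree_diagNumer_add_two_le : (diagNumer (dx - 1) A).natDegree + 2 ≤ dx + dy := by
  have := natDegree_diagNumer_le (N := dx - 1) (show A.degreeOf 1 ≤ dy - 1 by omega)
  omega

lemma genericQ_ne_zero : genericQ dx dy ≠ 0 := by
  rw [← leadingCoeff_ne_zero, leadingCoeff_genericQ]
  exact C_ne_zero.2 (genericCoeff_ne_zero _ _ _)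

include hQ hA hx hy

lemma isReducedForm_genericQ :
    IsReducedForm A (genericB dx dy) (diagNumer (dx - 1) A) (genericQ dx dy) := by
  refine ⟨genericQ_ne_zero, ?_, (isDiagLift_diagNumer A (by omega)).one_div_mul_div ?_⟩
  rotate_left
  · rw [Nat.sub_add_cancel (by omega)]
    exact isDiagLift_genericQ dx dy
  refine isRelPrime_of_irreducible (diagNumer_ne_zero hA (by omega)) hQ ?_ ?_
  · rw [leadingCoeff_genericQ]
    exact (isUnit_iff_ne_zero.2 (genericCoeff_ne_zero _ _ _)).map C
  · rw [natDegree_genericQ]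
    have := natDegree_diagNumer_add_two_le hx hy
    omega

/-- The reduced form is unique up to a constant. -/
lemma IsReducedForm.eq_C_mul {P Q : (GenericField dx dy)[X][X]}
    (h : IsReducedForm A (genericB dx dy) P Q) :
    ∃ a : GenericField dx dy, a ≠ 0 ∧ P = C (C a) * diagNumer (dx - 1) A ∧
      Q = C (C a) * genericQ dx dy := by
  obtain ⟨hQ0, hrel, heq⟩ := h
  obtain ⟨-, hrel', heq'⟩ := isReducedForm_genericQ hQ hA hx hy
  have hinj := IsFractionRing.injective (GenericField dx dy)[X][X]
    (FractionRing (GenericField dx dy)[X][X])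
  rw [heq', div_eq_div_iff ((map_ne_zero_iff _ hinj).2 genericQ_ne_zero)
    ((map_ne_zero_iff _ hinj).2 hQ0), ← map_mul, ← map_mul] at heq
  have heq := hinj heq
  have h1 : Q ∣ genericQ dx dy := hrel.symm.dvd_of_dvd_mul_left ⟨_, by rw [← heq, mul_comm]⟩
  have h2 : genericQ dx dy ∣ Q := hrel'.symm.dvd_of_dvd_mul_left ⟨_, by rw [heq, mul_comm]⟩
  obtain ⟨u, hu⟩ := associated_of_dvd_dvd h2 h1
  obtain ⟨v, hv, hv'⟩ := Polynomial.isUnit_iff.1 u.isUnit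
  obtain ⟨a, ha, ha'⟩ := Polynomial.isUnit_iff.1 hv
  rw [← hv', ← ha'] at hu
  refine ⟨a, ha.ne_zero, ?_, by rw [← hu]; ring⟩
  apply mul_right_cancel₀ (genericQ_ne_zero (dx := dx) (dy := dy))
  rw [← heq, ← hu]
  ring

end ReducedForm

/-! ### Weierstrass factorization and small branches -/

section SmallBranches

variable {k : Type*} [Field k]

instance isAdicComplete_maximalIdeal :
    IsAdicComplete (IsLocalRing.maximalIdeal (PowerSeries k)) (PowerSeries k) := by
  rw [PowerSeries.maximalIdeal_eq_span_X]
  infer_instance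

lemma mem_maximalIdeal_iff {a : PowerSeries k} :
    a ∈ IsLocalRing.maximalIdeal (PowerSeries k) ↔ PowerSeries.X ∣ a := by
  rw [PowerSeries.maximalIdeal_eq_span_X, Ideal.mem_span_singleton]

/-- A factorization `Q = W H` over `k⟦t⟧` that separates the small branches from the others, and a
partial fraction decomposition `P / Q = U / W + V / H`. -/
structure IsSmallFactorization (P Q : (PowerSeries k)[X]) (c : ℕ) (W H U V : (PowerSeries k)[X]) :
    Prop where
  eq_mul : Q = W * H
  monic : W.Monic
  natDegree_eq : W.natDegree = c
  dvd_coeff : ∀ i < c, PowerSeries.X ∣ W.coeff i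
  isUnit_coeff_zero : IsUnit (H.coeff 0)
  eq_add : P = U * H + W * V
  degree_lt : U.degree < c

/-- Division of `p` by the monic `W` is also a Weierstrass division; by uniqueness its quotient is
`q` and its remainder `0`. -/
lemma exists_eq_coe_of_isDistinguishedAt {A : Type*} [CommRing A] {I : Ideal A} (hI : I ≠ ⊤)
    [IsHausdorff I A] {W : A[X]} (hW : W.IsDistinguishedAt I) {p : A[X]} {q : PowerSeries A}
    (h : (p : PowerSeries A) = W * q) : ∃ q' : A[X], q = q' ∧ p = W * q' := by
  have : Nontrivial A := by
    by_contra hc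
    rw [not_nontrivial_iff_subsingleton] at hc
    exact hI (Subsingleton.elim _ _)
  have hord : ((W : PowerSeries A).map (Ideal.Quotient.mk I)).order.toNat = W.natDegree := by
    have h1 := hW.coe_natDegree_eq_order_map W 1
      (by rwa [PowerSeries.constantCoeff_one, ← Ideal.ne_top_iff_one]) (by simp)
    rw [← h1, ENat.toNat_natCast]
  have h2 := (hW.isWeierstrassDivisorAt hI).eq_of_mul_add_eq_mul_add (q := q)
    (q' := ((p /ₘ W : A[X]) : PowerSeries A)) (r := 0) (r' := p %ₘ W) (by simp) (by
      rw [hord, ← degree_eq_natDegree hW.monic.ne_zero]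
      exact degree_modByMonic_lt _ hW.monic) (by
      rw [← h, Polynomial.coe_zero, add_zero, ← Polynomial.coe_mul, ← Polynomial.coe_add, add_comm,
        modByMonic_add_div])
  refine ⟨p /ₘ W, h2.1, ?_⟩
  conv_lhs => rw [← modByMonic_add_div p W, ← h2.2, zero_add]

/-- Modulo `t`, `Q` has order `c` in `y`, so Weierstrass preparation gives `W` and a unit `H`.
Dividing `P H⁻¹` by `W` gives the remainder `U`, and `P - U H` is then a multiple of `W`. -/
theorem exists_isSmallFactorization (P : (PowerSeries k)[X]) {Q : (PowerSeries k)[X]} {c : ℕ}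
    (hlow : ∀ i < c, PowerSeries.X ∣ Q.coeff i) (htop : ¬PowerSeries.X ∣ Q.coeff c) :
    ∃ W H U V, IsSmallFactorization P Q c W H U V := by
  set I := IsLocalRing.maximalIdeal (PowerSeries k)
  have hI : I ≠ ⊤ := Ideal.IsPrime.ne_top'
  have hres : ∀ i, PowerSeries.coeff i ((Q : PowerSeries (PowerSeries k)).map
      (IsLocalRing.residue (PowerSeries k))) = 0 ↔ PowerSeries.X ∣ Q.coeff i := by
    intro i
    rw [PowerSeries.coeff_map, Polynomial.coeff_coe, IsLocalRing.residue_eq_zero_iff,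
      mem_maximalIdeal_iff]
  have hne : (Q : PowerSeries (PowerSeries k)).map (IsLocalRing.residue (PowerSeries k)) ≠ 0 := by
    intro h
    apply htop
    rw [← hres, h, map_zero]
  have hord : ((Q : PowerSeries (PowerSeries k)).map
      (IsLocalRing.residue (PowerSeries k))).order.toNat = c := by
    have : ((Q : PowerSeries (PowerSeries k)).map
      (IsLocalRing.residue (PowerSeries k))).order = c := by
      rw [PowerSeries.order_eq_nat]
      exact ⟨fun h => htop ((hres c).1 h), fun i hi => (hres i).2 (hlow i hi)⟩
    rw [this, ENat.toNat_natCast]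
  obtain ⟨W, h, hWh⟩ := PowerSeries.exists_isWeierstrassFactorization hne
  have hdist := hWh.isDistinguishedAt
  have hdeg : W.natDegree = c := by rw [hWh.natDegree_eq_toNat_order_map, hord]
  obtain ⟨H, hH, hQ⟩ := exists_eq_coe_of_isDistinguishedAt hI hdist hWh.eq_mul
  obtain ⟨v, hv⟩ := hWh.isUnit
  have hWord : ((W : PowerSeries (PowerSeries k)).map
      (IsLocalRing.residue (PowerSeries k))).order.toNat = W.natDegree := by
    have h1 := hdist.coe_natDegree_eq_order_map W 1
      (by rwa [PowerSeries.constantCoeff_one, ← Ideal.ne_top_iff_one]) (by simp)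
    exact (congrArg ENat.toNat h1).symm.trans (ENat.toNat_natCast _)
  have hWne : (W : PowerSeries (PowerSeries k)).map (IsLocalRing.residue (PowerSeries k)) ≠ 0 := by
    rw [← Polynomial.polynomial_map_coe, Ne, Polynomial.coe_eq_zero_iff]
    exact Polynomial.map_monic_ne_zero hdist.monic
  obtain ⟨q, U, hdiv⟩ := PowerSeries.exists_isWeierstrassDivision
    ((P : PowerSeries (PowerSeries k)) * ((v⁻¹ : (PowerSeries (PowerSeries k))ˣ) :
      PowerSeries (PowerSeries k))) hWne
  have hP : ((P - U * H : (PowerSeries k)[X]) : PowerSeries (PowerSeries k)) = W * (q * v) := by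
    have h1 := congrArg (· * (v : PowerSeries (PowerSeries k))) hdiv.eq_mul_add
    simp only [mul_assoc, Units.inv_mul, mul_one, add_mul] at h1
    rw [Polynomial.coe_sub, Polynomial.coe_mul, h1, ← hH, ← hv]
    ring
  obtain ⟨V, -, hV⟩ := exists_eq_coe_of_isDistinguishedAt hI hdist hP
  refine ⟨W, H, U, V, hQ, hdist.monic, hdeg, fun i hi => ?_, ?_, ?_, ?_⟩
  · exact mem_maximalIdeal_iff.1 (hdist.mem (by rwa [hdeg]))
  · have := PowerSeries.isUnit_iff_constantCoeff.1 hWh.isUnit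
    rwa [hH, Polynomial.constantCoeff_coe] at this
  · rw [← hV]
    ring
  · have := hdiv.degree_lt
    rw [← hdeg]
    exact this.trans_le (by rw [← hWord]; rfl)

local notation "Ω" => AlgebraicClosure (LaurentSeries k)

/-- Elements tending to zero do not divide units. -/
lemma TendsToZero.mul_ne_unit {y w : Ω} (hy : TendsToZero y) (hw : IsIntegral (PowerSeries k) w)
    {a : PowerSeries k} (ha : IsUnit a) : y * w ≠ algebraMap (PowerSeries k) Ω a := by
  obtain ⟨n, hn, z, hz, hyz⟩ := hy
  intro h
  obtain ⟨b, hb⟩ := (ha.pow n).exists_right_inv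
  have h1 : algebraMap (PowerSeries k) Ω PowerSeries.X *
      (z * w ^ n * algebraMap (PowerSeries k) Ω b) = 1 := by
    rw [← map_one (algebraMap (PowerSeries k) Ω), ← hb, map_mul, map_pow, ← h, mul_pow, hyz]
    ring
  have hint : IsIntegral (PowerSeries k) (z * w ^ n * algebraMap (PowerSeries k) Ω b) :=
    (hz.mul (hw.pow n)).mul isIntegral_algebraMap
  set x := z * w ^ n * algebraMap (PowerSeries k) Ω b
  have hX : algebraMap (PowerSeries k) (LaurentSeries k) PowerSeries.X ≠ 0 :=
    (map_ne_zero_iff _ (IsFractionRing.injective _ _)).2 PowerSeries.X_ne_zero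
  have hx : x = algebraMap (LaurentSeries k) Ω
      (algebraMap (PowerSeries k) (LaurentSeries k) PowerSeries.X)⁻¹ := by
    rw [map_inv₀, ← IsScalarTower.algebraMap_apply]
    exact eq_inv_of_mul_eq_one_right h1
  -- Otherwise `1/t` would be integral over the integrally closed ring `k⟦t⟧`.
  rw [hx, isIntegral_algebraMap_iff (algebraMap (LaurentSeries k) Ω).injective,
    IsIntegrallyClosed.isIntegral_iff] at hint
  obtain ⟨s, hs⟩ := hint
  have h2 : PowerSeries.X * s = (1 : PowerSeries k) := by
    apply IsFractionRing.injective (PowerSeries k) (LaurentSeries k)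
    rw [map_mul, hs, mul_inv_cancel₀ hX, map_one]
  have := congrArg PowerSeries.constantCoeff h2
  simp at this

lemma TendsToZero.isIntegral {y : Ω} (hy : TendsToZero y) : IsIntegral (PowerSeries k) y := by
  obtain ⟨n, hn, z, hz, hyz⟩ := hy
  refine IsIntegral.of_pow hn ?_
  rw [hyz]
  exact isIntegral_algebraMap.mul hz

variable {P Q W H U V : (PowerSeries k)[X]} {c : ℕ}

/-- All lower coefficients of the monic `W` are divisible by `t`, so `W(y) = 0` exhibits `y^c` as
`t` times an integral element. -/
lemma IsSmallFactorization.tendsToZero (h : IsSmallFactorization P Q c W H U V) (hc : 0 < c)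
    {y : Ω} (hy : (W.map (algebraMap (PowerSeries k) Ω)).IsRoot y) : TendsToZero y := by
  have hint : IsIntegral (PowerSeries k) y := ⟨W, h.monic, by rwa [IsRoot, eval_map] at hy⟩
  choose! w hw using h.dvd_coeff
  refine ⟨c, hc, -∑ i ∈ Finset.range c, algebraMap (PowerSeries k) Ω (w i) * y ^ i, ?_, ?_⟩
  · have hterm : ∀ i, IsIntegral (PowerSeries k) (algebraMap (PowerSeries k) Ω (w i) * y ^ i) :=
      fun i => isIntegral_algebraMap.mul (hint.pow i)
    exact IsIntegral.neg (IsIntegral.sum _ fun i _ => hterm i)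
  · rw [IsRoot, eval_map, eval₂_eq_sum_range, h.natDegree_eq, Finset.sum_range_succ] at hy
    have h1 := h.monic.coeff_natDegree
    rw [h.natDegree_eq] at h1
    rw [h1, map_one, one_mul] at hy
    have hs : ∑ i ∈ Finset.range c, algebraMap (PowerSeries k) Ω (W.coeff i) * y ^ i =
        algebraMap (PowerSeries k) Ω PowerSeries.X *
          ∑ i ∈ Finset.range c, algebraMap (PowerSeries k) Ω (w i) * y ^ i := by
      rw [Finset.mul_sum]
      refine Finset.sum_congr rfl fun i hi => ?_
      rw [hw i (Finset.mem_range.1 hi), map_mul, mul_assoc]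
    rw [hs] at hy
    linear_combination hy

/-- `H(y) = 0` writes the unit `H(0)` as `y` times an element that would be integral if `y` were
small. -/
lemma IsSmallFactorization.not_tendsToZero (h : IsSmallFactorization P Q c W H U V)
    {y : Ω} (hy : (H.map (algebraMap (PowerSeries k) Ω)).IsRoot y) : ¬TendsToZero y := by
  intro hz
  have hint := hz.isIntegral
  refine hz.mul_ne_unit (w := eval₂ (algebraMap (PowerSeries k) Ω) y (-H.divX)) ?_
    h.isUnit_coeff_zero ?_
  · rw [eval₂_eq_sum_range]
    exact IsIntegral.sum _ fun i _ => isIntegral_algebraMap.mul (hint.pow i)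
  · rw [IsRoot, eval_map, ← divX_mul_X_add H] at hy
    simp only [eval₂_add, eval₂_mul, eval₂_X, eval₂_C, eval₂_neg] at hy ⊢
    linear_combination -hy

end SmallBranches

/-! ### The sum of the residues at the small branches -/

section SumOverBranches

variable {k : Type*} [Field k] {P Q W H U V : (PowerSeries k)[X]} {c d : ℕ}

local notation "Ω" => AlgebraicClosure (LaurentSeries k)

lemma algebraMap_powerSeries_injective :
    Function.Injective (algebraMap (PowerSeries k) Ω) := by
  rw [IsScalarTower.algebraMap_eq (PowerSeries k) (LaurentSeries k) Ω]
  exact (algebraMap (LaurentSeries k) Ω).injective.comp (IsFractionRing.injective _ _)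

/-- The branches of `Q`, the small ones first, and the sum of the residues at the small ones. -/
theorem IsSmallFactorization.exists_branches (h : IsSmallFactorization P Q c W H U V) (hc : 0 < c)
    (hdeg : Q.natDegree = c + d) (hQ0 : Q ≠ 0)
    (hsep : (Q.map (algebraMap (PowerSeries k) Ω)).Separable) :
    ∃ (l : Ω) (Y : Fin c ⊕ Fin d → Ω), l ≠ 0 ∧ Function.Injective Y ∧
      Q.map (algebraMap (PowerSeries k) Ω) = C l * ∏ i, (X - C (Y i)) ∧
      {y | (Q.map (algebraMap (PowerSeries k) Ω)).IsRoot y ∧ TendsToZero y} =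
        Set.range (fun i => Y (Sum.inl i)) ∧
      ∑ i : Fin c, (P.map (algebraMap (PowerSeries k) Ω)).eval (Y (Sum.inl i)) /
        (derivative (Q.map (algebraMap (PowerSeries k) Ω))).eval (Y (Sum.inl i)) =
        algebraMap (PowerSeries k) Ω (U.coeff (c - 1)) := by
  set α := algebraMap (PowerSeries k) Ω with hα
  have hαinj : Function.Injective α := algebraMap_powerSeries_injective
  have hH0 : H ≠ 0 := by
    rintro rfl
    exact hQ0 (by rw [h.eq_mul, mul_zero])
  have hHdeg : H.natDegree = d := by
    have h1 := h.monic.natDegree_mul' hH0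
    rw [← h.eq_mul, hdeg, h.natDegree_eq] at h1
    omega
  obtain ⟨y₁, hy₁⟩ := exists_eq_C_mul_prod (IsAlgClosed.splits (W.map α))
    ((natDegree_map_eq_of_injective hαinj W).trans h.natDegree_eq)
  obtain ⟨y₂, hy₂⟩ := exists_eq_C_mul_prod (IsAlgClosed.splits (H.map α))
    ((natDegree_map_eq_of_injective hαinj H).trans hHdeg)
  rw [(h.monic.map α).leadingCoeff] at hy₁
  set l := (H.map α).leadingCoeff with hl
  have hl0 : l ≠ 0 := by
    rw [hl, leadingCoeff_ne_zero, Ne, Polynomial.map_eq_zero_iff hαinj]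
    exact hH0
  have hQm : Q.map α = W.map α * H.map α := by rw [h.eq_mul, Polynomial.map_mul]
  have hprod : Q.map α = C l * ∏ i, (X - C (Sum.elim y₁ y₂ i)) := by
    rw [hQm, hy₁, hy₂, Fintype.prod_sum_type]
    simp only [Sum.elim_inl, Sum.elim_inr, C_1]
    ring
  have hinj : Function.Injective (Sum.elim y₁ y₂) := by
    rw [hprod] at hsep
    exact (hsep.of_mul_right).injective_of_prod_X_sub_C
  have hW : ∀ i, (W.map α).IsRoot (y₁ i) := fun i => by
    rw [hy₁, IsRoot, eval_mul, eval_prod, Finset.prod_eq_zero (Finset.mem_univ i) (by simp),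
      mul_zero]
  have hHne : ∀ i, (H.map α).eval (y₁ i) ≠ 0 := fun i h0 =>
    h.not_tendsToZero h0 (h.tendsToZero hc (hW i))
  refine ⟨l, Sum.elim y₁ y₂, hl0, hinj, hprod, ?_, ?_⟩
  · ext y
    simp only [Set.mem_ofPred_eq, Sum.elim_inl, Set.mem_range]
    constructor
    · rintro ⟨hr, ht⟩
      rw [hQm, IsRoot, eval_mul, mul_eq_zero] at hr
      have hr := hr.resolve_right fun h0 => h.not_tendsToZero h0 ht
      rw [hy₁, eval_mul, eval_prod, C_1, eval_one, one_mul, Finset.prod_eq_zero_iff] at hr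
      obtain ⟨i, -, hi⟩ := hr
      refine ⟨i, ?_⟩
      rw [eval_sub, eval_X, eval_C, sub_eq_zero] at hi
      exact hi.symm
    · rintro ⟨i, rfl⟩
      refine ⟨?_, h.tendsToZero hc (hW i)⟩
      rw [hQm, IsRoot, eval_mul, hW i, zero_mul]
  · have hy₁inj : Function.Injective y₁ := fun i j hij => Sum.inl_injective (hinj hij)
    have hUdeg : (U.map α).degree < ((Fintype.card (Fin c) : ℕ) : WithBot ℕ) := by
      rw [Fintype.card_fin]
      exact degree_map_le.trans_lt h.degree_lt
    -- At a root of `W` one has `P = U H` and `Q' = W' H` with `H ≠ 0`, so the residues of `P/Q`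
    -- there are those of `U/W`.
    have hsum := sum_eval_div_eval_derivative (l := (1 : Ω)) hy₁inj hUdeg
    rw [← hy₁, Fintype.card_fin, coeff_map, div_one] at hsum
    rw [← hsum]
    refine Finset.sum_congr rfl fun i _ => ?_
    have h1 : (P.map α).eval (y₁ i) = (U.map α).eval (y₁ i) * (H.map α).eval (y₁ i) := by
      rw [h.eq_add, Polynomial.map_add, Polynomial.map_mul, Polynomial.map_mul, eval_add, eval_mul,
        eval_mul, (hW i).eq_zero, zero_mul, add_zero]
    have h2 : (derivative (Q.map α)).eval (y₁ i) =
        (derivative (W.map α)).eval (y₁ i) * (H.map α).eval (y₁ i) := by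
      rw [hQm, derivative_mul, eval_add, eval_mul, eval_mul, (hW i).eq_zero, zero_mul, add_zero]
    rw [Sum.elim_inl, h1, h2, mul_div_mul_right _ _ (hHne i)]

end SumOverBranches

/-! ### Coefficient extraction in `k((y))⟦t⟧` -/

section DiagonalResidue

variable {k : Type*} [Field k]

/-- The coefficient of `y^m` of a series in `k((y))⟦t⟧`, as a series in `k⟦t⟧`. -/
def yCoeff (m : ℤ) (F : PowerSeries (LaurentSeries k)) : PowerSeries k :=
  PowerSeries.mk fun n => (PowerSeries.coeff n F).coeff m

/-- The embedding of `k⟦t⟧` in `k((y))⟦t⟧`. -/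
def tEmb (k : Type*) [Field k] : PowerSeries k →+* PowerSeries (LaurentSeries k) :=
  PowerSeries.map HahnSeries.C

/-- The variable `y` of `k((y))⟦t⟧`. -/
def yVar (k : Type*) [Field k] : PowerSeries (LaurentSeries k) :=
  PowerSeries.C (HahnSeries.single 1 1)

/-- The embedding of `k⟦t⟧[y]` in `k((y))⟦t⟧`. -/
def polyEmb (k : Type*) [Field k] : (PowerSeries k)[X] →+* PowerSeries (LaurentSeries k) :=
  eval₂RingHom (tEmb k) (yVar k)

lemma yCoeff_add (m : ℤ) (F G : PowerSeries (LaurentSeries k)) :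
    yCoeff m (F + G) = yCoeff m F + yCoeff m G := by
  ext n
  simp [yCoeff]

lemma yCoeff_sum {ι : Type*} (m : ℤ) (s : Finset ι) (F : ι → PowerSeries (LaurentSeries k)) :
    yCoeff m (∑ i ∈ s, F i) = ∑ i ∈ s, yCoeff m (F i) :=
  map_sum (⟨⟨yCoeff m, by ext n; simp [yCoeff]⟩, yCoeff_add m⟩ :
    PowerSeries (LaurentSeries k) →+ PowerSeries k) F s

lemma yCoeff_tEmb_mul (m : ℤ) (a : PowerSeries k) (F : PowerSeries (LaurentSeries k)) :
    yCoeff m (tEmb k a * F) = a * yCoeff m F := by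
  ext n
  rw [yCoeff, PowerSeries.coeff_mk, PowerSeries.coeff_mul, PowerSeries.coeff_mul,
    HahnSeries.coeff_sum]
  refine Finset.sum_congr rfl fun p _ => ?_
  rw [tEmb, PowerSeries.coeff_map, HahnSeries.C_mul_eq_smul, HahnSeries.coeff_smul, smul_eq_mul,
    yCoeff, PowerSeries.coeff_mk]

lemma yCoeff_yVar_pow_mul (m : ℤ) (l : ℕ) (F : PowerSeries (LaurentSeries k)) :
    yCoeff m (yVar k ^ l * F) = yCoeff (m - l) F := by
  ext n
  rw [yCoeff, yCoeff, PowerSeries.coeff_mk, PowerSeries.coeff_mk, yVar, ← map_pow,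
    PowerSeries.coeff_C_mul, HahnSeries.single_pow, HahnSeries.coeff_single_mul]
  simp

lemma yCoeff_polyEmb_mul (m : ℤ) (p : (PowerSeries k)[X]) {N : ℕ} (hN : p.natDegree < N)
    (F : PowerSeries (LaurentSeries k)) :
    yCoeff m (polyEmb k p * F) = ∑ l ∈ Finset.range N, p.coeff l * yCoeff (m - l) F := by
  rw [polyEmb, coe_eval₂RingHom, eval₂_eq_sum_range' _ hN, Finset.sum_mul, yCoeff_sum]
  refine Finset.sum_congr rfl fun l _ => ?_
  rw [mul_assoc, yCoeff_tEmb_mul, yCoeff_yVar_pow_mul]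

lemma yCoeff_one (m : ℤ) :
    yCoeff m (1 : PowerSeries (LaurentSeries k)) = if m = 0 then 1 else 0 := by
  ext n
  rw [yCoeff, PowerSeries.coeff_mk, PowerSeries.coeff_one]
  split_ifs with h1 h2 h2
  · subst h1 h2; simp
  · subst h1; simp [h2]
  · subst h2; simp [PowerSeries.coeff_one, h1]
  · simp

section Expansion

variable {W : (PowerSeries k)[X]} {c : ℕ} (hW : W.Monic) (hdeg : W.natDegree = c)
  (hdvd : ∀ i < c, PowerSeries.X ∣ W.coeff i) {F : PowerSeries (LaurentSeries k)}
  (hF : polyEmb k W * F = 1)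

include hW hdeg hF

lemma yCoeff_recurrence (m : ℤ) :
    yCoeff (m - c) F = (if m = 0 then 1 else 0) -
      ∑ l ∈ Finset.range c, W.coeff l * yCoeff (m - l) F := by
  have h1 := yCoeff_polyEmb_mul m W (Nat.lt_succ_self W.natDegree) F
  rw [hF, yCoeff_one, Nat.succ_eq_add_one, Finset.sum_range_succ, hW.coeff_natDegree, one_mul,
    hdeg] at h1
  rw [h1]
  ring

include hdvd

/-- `1/W` starts at `y^(-c)` and continues in lower powers of `y`. Each use of the recurrence gains
a factor `t` while staying in the range `m > -c`, so these coefficients are divisible by all powers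
of `t`. -/
lemma yCoeff_eq_zero {m : ℤ} (hm : -(c : ℤ) < m) : yCoeff m F = 0 := by
  have key : ∀ N : ℕ, ∀ m : ℤ, -(c : ℤ) < m → PowerSeries.X ^ N ∣ yCoeff m F := by
    intro N
    induction N with
    | zero => intro m _; simp
    | succ N ih =>
      intro m hm
      have h1 := yCoeff_recurrence hW hdeg hF (m + c)
      rw [add_sub_cancel_right, if_neg (by omega), zero_sub] at h1
      rw [h1, dvd_neg]
      refine Finset.dvd_sum fun l hl => ?_
      have hl := Finset.mem_range.1 hl
      rw [pow_succ']
      exact mul_dvd_mul (hdvd l hl) (ih _ (by omega))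
  ext n
  rw [map_zero]
  exact (PowerSeries.X_pow_dvd_iff.1 (key (n + 1) m hm)) n (Nat.lt_succ_self n)

lemma yCoeff_neg_natDegree : yCoeff (-(c : ℤ)) F = 1 := by
  have h1 := yCoeff_recurrence hW hdeg hF 0
  rw [zero_sub, if_pos rfl, Finset.sum_eq_zero, sub_zero] at h1
  · exact h1
  · intro l hl
    have hl := Finset.mem_range.1 hl
    rw [yCoeff_eq_zero hW hdeg hdvd hF (by omega), mul_zero]

/-- The residue at the small branches of `U / W` is read at infinity. -/
lemma yCoeff_polyEmb_mul_inv (hc : 0 < c) {U : (PowerSeries k)[X]} (hU : U.degree < c) :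
    yCoeff (-1) (polyEmb k U * F) = U.coeff (c - 1) := by
  have hU' : U.natDegree < c := by
    by_cases h0 : U = 0
    · rw [h0, natDegree_zero]; exact hc
    · rwa [natDegree_lt_iff_degree_lt h0]
  rw [yCoeff_polyEmb_mul _ _ hU', Finset.sum_eq_single (c - 1)]
  · rw [show (-1 : ℤ) - ((c - 1 : ℕ) : ℤ) = -(c : ℤ) by omega,
      yCoeff_neg_natDegree hW hdeg hdvd hF, mul_one]
  · intro l hl hne
    have hl := Finset.mem_range.1 hl
    rw [yCoeff_eq_zero hW hdeg hdvd hF (by omega), mul_zero]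
  · intro h
    exact absurd (Finset.mem_range.2 (by omega)) h

end Expansion

/-- The embedding of `k⟦y⟧⟦t⟧` in `k((y))⟦t⟧`. -/
def seriesEmb (k : Type*) [Field k] :
    PowerSeries (PowerSeries k) →+* PowerSeries (LaurentSeries k) :=
  PowerSeries.map (HahnSeries.ofPowerSeries ℤ k)

/-- The embedding of `k⟦t⟧[y]` in `k⟦y⟧⟦t⟧`. -/
def polySeriesEmb (k : Type*) [Field k] : (PowerSeries k)[X] →+* PowerSeries (PowerSeries k) :=
  eval₂RingHom (PowerSeries.map PowerSeries.C) (PowerSeries.C PowerSeries.X)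

lemma seriesEmb_polySeriesEmb (p : (PowerSeries k)[X]) :
    seriesEmb k (polySeriesEmb k p) = polyEmb k p := by
  have : (seriesEmb k).comp (polySeriesEmb k) = polyEmb k := by
    refine Polynomial.ringHom_ext' (RingHom.ext fun a => ?_) ?_
    · ext n
      simp [seriesEmb, polySeriesEmb, polyEmb, tEmb]
    · simp [seriesEmb, polySeriesEmb, polyEmb, yVar]
  exact RingHom.congr_fun this p

lemma yCoeff_seriesEmb_of_neg {m : ℤ} (hm : m < 0) (F : PowerSeries (PowerSeries k)) :
    yCoeff m (seriesEmb k F) = 0 := by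
  ext n
  rw [yCoeff, PowerSeries.coeff_mk, seriesEmb, PowerSeries.coeff_map, map_zero,
    HahnSeries.ofPowerSeries_apply]
  apply HahnSeries.embDomain_of_notMem_range
  rintro ⟨x, hx⟩
  simp at hx
  omega

/-- `H` is already invertible in `k⟦y⟧⟦t⟧`, so `V/H` has no negative powers of `y`. -/
lemma isUnit_polySeriesEmb {H : (PowerSeries k)[X]} (hH : IsUnit (H.coeff 0)) :
    IsUnit (polySeriesEmb k H) := by
  rw [PowerSeries.isUnit_iff_constantCoeff, PowerSeries.isUnit_iff_constantCoeff]
  have : (PowerSeries.constantCoeff (R := k)).comp ((PowerSeries.constantCoeff).comp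
      (polySeriesEmb k)) = (PowerSeries.constantCoeff (R := k)).comp
        (Polynomial.constantCoeff) := by
    refine Polynomial.ringHom_ext' (RingHom.ext fun a => ?_) ?_
    · simp only [RingHom.comp_apply, polySeriesEmb, coe_eval₂RingHom, eval₂_C,
        ← PowerSeries.coeff_zero_eq_constantCoeff_apply, PowerSeries.coeff_map]
      simp
    · simp [polySeriesEmb]
  have h2 := RingHom.congr_fun this H
  simp only [RingHom.comp_apply] at h2
  rw [h2]
  exact hH.map PowerSeries.constantCoeff

/-- Modulo `t`, `W` is a power of `y`, which is a unit in `k((y))`. -/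
lemma isUnit_polyEmb_of_monic {W : (PowerSeries k)[X]} (hW : W.Monic)
    (hdvd : ∀ i < W.natDegree, PowerSeries.X ∣ W.coeff i) : IsUnit (polyEmb k W) := by
  rw [PowerSeries.isUnit_iff_constantCoeff, isUnit_iff_ne_zero]
  rw [polyEmb, coe_eval₂RingHom, eval₂_eq_sum_range, map_sum, Finset.sum_range_succ,
    Finset.sum_eq_zero, hW.coeff_natDegree, map_one, one_mul, map_pow, yVar,
    PowerSeries.constantCoeff_C, zero_add]
  · refine pow_ne_zero _ ?_
    simp
  · intro i hi
    obtain ⟨a, ha⟩ := hdvd i (Finset.mem_range.1 hi)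
    rw [ha, map_mul, map_mul, map_mul, tEmb, PowerSeries.map_X, PowerSeries.constantCoeff_X,
      zero_mul, zero_mul]

/-- The coefficient of `1 / y` of `P / Q`, expanded in `k((y))⟦t⟧`. -/
theorem IsSmallFactorization.yCoeff_eq {P Q W H U V : (PowerSeries k)[X]} {c : ℕ}
    (h : IsSmallFactorization P Q c W H U V) (hc : 0 < c) {F : PowerSeries (LaurentSeries k)}
    (hF : F * polyEmb k Q = polyEmb k P) : yCoeff (-1) F = U.coeff (c - 1) := by
  obtain ⟨G, hG⟩ := (isUnit_polySeriesEmb h.isUnit_coeff_zero).exists_right_inv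
  have hG' := congrArg (seriesEmb k) hG
  rw [map_mul, seriesEmb_polySeriesEmb, map_one] at hG'
  obtain ⟨W', hW'⟩ := (isUnit_polyEmb_of_monic h.monic
    (by rw [h.natDegree_eq]; exact h.dvd_coeff)).exists_right_inv
  -- The partial fraction decomposition `U/W + V/H`; only the first term can contribute to `1/y`.
  have hF' : F = polyEmb k U * W' + seriesEmb k (polySeriesEmb k V * G) := by
    rw [h.eq_mul, h.eq_add, map_mul, map_add, map_mul, map_mul] at hF
    rw [map_mul, seriesEmb_polySeriesEmb]
    linear_combination (W' * seriesEmb k G) * hF +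
      (polyEmb k U * W' - F * polyEmb k W * W') * hG' +
      (polyEmb k V * seriesEmb k G - F) * hW'
  rw [hF', yCoeff_add, yCoeff_seriesEmb_of_neg (by norm_num), add_zero,
    yCoeff_polyEmb_mul_inv h.monic h.natDegree_eq h.dvd_coeff hW' hc h.degree_lt]

end DiagonalResidue

/-! ### The substitution `x = t/y` and the diagonal -/

section Substitution

variable {k : Type*} [Field k]

/-- Power series in one variable indexed by `Fin 1`, as univariate power series. -/
def finOneSeries (k : Type*) [Field k] : MvPowerSeries (Fin 1) k →+* PowerSeries k :=
  (MvPowerSeries.rename (R := k) (Equiv.ofUnique (Fin 1) Unit)).toRingHom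

lemma coeff_finOneSeries (f : MvPowerSeries (Fin 1) k) (n : ℕ) :
    PowerSeries.coeff n (finOneSeries k f) = MvPowerSeries.coeff (Finsupp.single 0 n) f := by
  have h := MvPowerSeries.coeff_embDomain_rename (R := k)
    (Equiv.ofUnique (Fin 1) Unit).toEmbedding f (Finsupp.single 0 n)
  rw [Finsupp.embDomain_single] at h
  exact h

/-- The substitution `f(x, y) ↦ f(t / y, y)` from `k⟦x, y⟧` to `k((y))⟦t⟧`. -/
def diagSubst (k : Type*) [Field k] :
    MvPowerSeries (Fin 2) k →+* PowerSeries (LaurentSeries k) :=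
  ((PowerSeries.rescale (HahnSeries.single (-1) 1 : LaurentSeries k)).comp (seriesEmb k)).comp
    ((PowerSeries.map (finOneSeries k)).comp
      (MvPowerSeries.finSuccEquiv k 1).toAlgHom.toRingHom)

lemma diagSubst_apply (f : MvPowerSeries (Fin 2) k) : diagSubst k f =
    PowerSeries.rescale (HahnSeries.single (-1) 1 : LaurentSeries k)
      (seriesEmb k (PowerSeries.map (finOneSeries k) (MvPowerSeries.finSuccEquiv k 1 f))) :=
  rfl

lemma finOneSeries_C (a : k) : finOneSeries k (MvPowerSeries.C a) = PowerSeries.C a :=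
  MvPowerSeries.rename_C _ a

lemma finOneSeries_X : finOneSeries k (MvPowerSeries.X 0) = PowerSeries.X :=
  MvPowerSeries.rename_X _ 0

lemma rescale_C {R : Type*} [CommRing R] (a b : R) :
    PowerSeries.rescale a (PowerSeries.C b) = PowerSeries.C b := by
  ext n
  rw [PowerSeries.coeff_rescale, PowerSeries.coeff_C]
  split_ifs with h
  · rw [h, pow_zero, one_mul]
  · rw [mul_zero]

lemma diagSubst_C (a : k) :
    diagSubst k (MvPowerSeries.C a) = PowerSeries.C (HahnSeries.C a) := by
  rw [diagSubst_apply, MvPowerSeries.finSuccEquiv_C, PowerSeries.map_C, finOneSeries_C, seriesEmb,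
    PowerSeries.map_C, HahnSeries.ofPowerSeries_C, rescale_C]

lemma diagSubst_X_one : diagSubst k (MvPowerSeries.X 1) = yVar k := by
  rw [diagSubst_apply, show (1 : Fin 2) = Fin.succ 0 from rfl, MvPowerSeries.finSuccEquiv_X_succ,
    PowerSeries.map_C, finOneSeries_X, seriesEmb, PowerSeries.map_C, HahnSeries.ofPowerSeries_X,
    rescale_C, yVar]

lemma diagSubst_X_zero_mul : diagSubst k (MvPowerSeries.X 0) * yVar k = PowerSeries.X := by
  rw [diagSubst_apply, MvPowerSeries.finSuccEquiv_X_zero, PowerSeries.map_X, seriesEmb,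
    PowerSeries.map_X, PowerSeries.rescale_X, yVar, mul_right_comm, ← map_mul,
    HahnSeries.single_mul_single]
  simp

/-- `x^i y^j` becomes `t^i y^(j-i)`, so the power `y^0` selects `i = j`. -/
lemma yCoeff_zero_diagSubst (f : MvPowerSeries (Fin 2) k) : yCoeff 0 (diagSubst k f) = diag f := by
  ext n
  rw [yCoeff, PowerSeries.coeff_mk, diag, PowerSeries.coeff_mk, diagSubst_apply,
    PowerSeries.coeff_rescale, HahnSeries.single_pow, seriesEmb, PowerSeries.coeff_map,
    PowerSeries.coeff_map, HahnSeries.coeff_single_mul, one_pow, one_mul]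
  rw [show (0 : ℤ) - n • (-1 : ℤ) = (n : ℕ) by simp, HahnSeries.ofPowerSeries_apply_coeff,
    coeff_finOneSeries, MvPowerSeries.coeff_coeff_finSuccEquiv]
  congr 2
  ext i
  fin_cases i
  · simp
  · exact (Finsupp.cons_succ 0 n (Finsupp.single (0 : Fin 1) n)).trans (by simp)

/-- `k[t][y]` inside `k⟦t⟧[y]`. -/
def toSeriesPoly (k : Type*) [Field k] : k[X][X] →+* (PowerSeries k)[X] :=
  mapRingHom coeToPowerSeries.ringHom

/-- `A(t / y, y)` in `k((y))⟦t⟧`. -/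
def polySubst (k : Type*) [Field k] :
    MvPolynomial (Fin 2) k →+* PowerSeries (LaurentSeries k) :=
  (diagSubst k).comp MvPolynomial.coeToMvPowerSeries.ringHom

lemma polyEmb_toSeriesPoly_X : (polyEmb k).comp (toSeriesPoly k) X = yVar k := by
  simp [toSeriesPoly, polyEmb]

lemma polyEmb_toSeriesPoly_C_C (a : k) :
    (polyEmb k).comp (toSeriesPoly k) (C (C a)) = polySubst k (MvPolynomial.C a) := by
  simp [toSeriesPoly, polyEmb, polySubst, diagSubst_C, tEmb]

lemma polySubst_X_zero_mul : polySubst k (MvPolynomial.X 0) * (polyEmb k).comp (toSeriesPoly k) X =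
    (polyEmb k).comp (toSeriesPoly k) (C X) := by
  rw [polyEmb_toSeriesPoly_X]
  simp [polySubst, diagSubst_X_zero_mul, toSeriesPoly, polyEmb, tEmb]

lemma polySubst_X_one :
    polySubst k (MvPolynomial.X 1) = (polyEmb k).comp (toSeriesPoly k) X := by
  rw [polyEmb_toSeriesPoly_X]
  simp [polySubst, diagSubst_X_one]

/-- The diagonal of `A / B` is the coefficient of `1 / y` of `(1 / y) (A / B)(t / y, y)`. -/
lemma exists_mul_polyEmb_eq {A B : MvPolynomial (Fin 2) k} {P Q : k[X][X]} {N : ℕ}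
    (hB : B.coeff 0 ≠ 0)
    (hP : polySubst k A * (polyEmb k).comp (toSeriesPoly k) X ^ N =
      (polyEmb k).comp (toSeriesPoly k) P)
    (hQ : polySubst k B * (polyEmb k).comp (toSeriesPoly k) X ^ (N + 1) =
      (polyEmb k).comp (toSeriesPoly k) Q) :
    ∃ F, F * polyEmb k (toSeriesPoly k Q) = polyEmb k (toSeriesPoly k P) ∧
      yCoeff (-1) F = ratDiag A B := by
  have hy : PowerSeries.C (HahnSeries.single (-1) 1 : LaurentSeries k) * yVar k = 1 := by
    rw [yVar, ← map_mul, HahnSeries.single_mul_single]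
    simp
  have hBB : diagSubst k (B : MvPowerSeries (Fin 2) k)⁻¹ * diagSubst k B = 1 := by
    rw [← map_mul, MvPowerSeries.inv_mul_cancel, map_one]
    rwa [← MvPowerSeries.coeff_zero_eq_constantCoeff_apply, MvPolynomial.coeff_coe]
  rw [polyEmb_toSeriesPoly_X] at hP hQ
  simp only [polySubst, RingHom.comp_apply, MvPolynomial.coeToMvPowerSeries.ringHom_apply] at hP hQ
  refine ⟨PowerSeries.C (HahnSeries.single (-1) 1 : LaurentSeries k) *
    diagSubst k ((A : MvPowerSeries (Fin 2) k) * (B : MvPowerSeries (Fin 2) k)⁻¹), ?_, ?_⟩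
  · rw [← hP, ← hQ, map_mul, pow_succ]
    linear_combination (diagSubst k A * diagSubst k (B : MvPowerSeries (Fin 2) k)⁻¹ *
      diagSubst k B * yVar k ^ N) * hy + (diagSubst k A * yVar k ^ N) * hBB
  · rw [ratDiag, ← yCoeff_zero_diagSubst]
    have h3 := yCoeff_yVar_pow_mul 0 1
      (PowerSeries.C (HahnSeries.single (-1) 1 : LaurentSeries k) *
        diagSubst k ((A : MvPowerSeries (Fin 2) k) * (B : MvPowerSeries (Fin 2) k)⁻¹))
    rw [pow_one, ← mul_assoc, mul_comm (yVar k), hy, one_mul] at h3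
    rw [h3]
    simp

end Substitution

/-! ### The generic diagonal and the factorization of its denominator -/

section GenericDiagonal

variable {dx dy : ℕ} {A : MvPolynomial (Fin 2) (GenericField dx dy)}

lemma coeff_zero_genericB :
    (genericB dx dy).coeff 0 = genericCoeff dx dy (0, 0) := by
  rw [← MvPolynomial.constantCoeff_eq, genericB, map_sum, Finset.sum_eq_single 0, map_sum,
    Finset.sum_eq_single 0]
  · simp [genericCoeff]
  · intro j _ hj
    simp [Fin.val_ne_zero_iff.2 hj]
  · simp
  · intro i _ hi
    simp [Fin.val_ne_zero_iff.2 hi]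
  · simp

/-- The diagonal of `A / B` as a coefficient of a numerator over the small branches. -/
theorem IsSmallFactorization.coeff_eq_ratDiag {W H U V : (PowerSeries (GenericField dx dy))[X]}
    (h : IsSmallFactorization (toSeriesPoly _ (diagNumer (dx - 1) A))
      (toSeriesPoly _ (genericQ dx dy)) dx W H U V) (hx : A.degreeOf 0 < dx) :
    U.coeff (dx - 1) = ratDiag A (genericB dx dy) := by
  obtain ⟨F, hF, hF'⟩ := exists_mul_polyEmb_eq (A := A) (B := genericB dx dy)
    (P := diagNumer (dx - 1) A) (Q := genericQ dx dy) (N := dx - 1)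
    (by rw [coeff_zero_genericB]; exact genericCoeff_ne_zero _ _ _)
    (map_mul_pow_eq_map_diagNumer _ _ polyEmb_toSeriesPoly_C_C polySubst_X_zero_mul
      polySubst_X_one (by omega)) (by
      rw [Nat.sub_add_cancel (by omega)]
      exact map_genericB_mul_pow _ _ polyEmb_toSeriesPoly_C_C polySubst_X_zero_mul polySubst_X_one)
  rw [← hF', h.yCoeff_eq (by omega) hF]

/-- At `t = 0` the polynomial `y^{dx} B(t / y, y)` is `y^{dx} B(0, y)`. -/
lemma coeff_zero_coeff_genericQ_of_lt {m : ℕ} (hm : m < dx) :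
    ((genericQ dx dy).coeff m).coeff 0 = 0 := by
  simp only [genericQ, finsetSum_coeff, coeff_C_mul_X_pow]
  refine Finset.sum_eq_zero fun i _ => Finset.sum_eq_zero fun j _ => ?_
  split_ifs with h
  · rw [coeff_C_mul_X_pow, if_neg (by omega)]
  · rw [coeff_zero]

lemma coeff_zero_coeff_genericQ_self :
    ((genericQ dx dy).coeff dx).coeff 0 = genericCoeff dx dy (0, 0) := by
  simp only [genericQ, finsetSum_coeff, coeff_C_mul_X_pow]
  rw [Finset.sum_eq_single 0, Finset.sum_eq_single 0]
  · simp
  · intro j _ hj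
    have := Fin.val_ne_zero_iff.2 hj
    rw [if_neg (by simp only [Fin.val_zero]; omega), coeff_zero]
  · simp
  · intro i _ hi
    have := Fin.val_ne_zero_iff.2 hi
    refine Finset.sum_eq_zero fun j _ => ?_
    split_ifs with h
    · rw [coeff_C_mul_X_pow, if_neg (Ne.symm this)]
    · rw [coeff_zero]
  · simp

lemma X_dvd_coeff_toSeriesPoly_iff {k : Type*} [Field k] (P : k[X][X]) (m : ℕ) :
    PowerSeries.X ∣ (toSeriesPoly k P).coeff m ↔ (P.coeff m).coeff 0 = 0 := by
  rw [PowerSeries.X_dvd_iff, ← PowerSeries.coeff_zero_eq_constantCoeff_apply, toSeriesPoly,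
    coe_mapRingHom, coeff_map, coeToPowerSeries.ringHom_apply, Polynomial.coeff_coe]

lemma exists_isSmallFactorization_genericQ (P : (PowerSeries (GenericField dx dy))[X]) :
    ∃ W H U V, IsSmallFactorization P (toSeriesPoly _ (genericQ dx dy)) dx W H U V := by
  refine exists_isSmallFactorization _ (fun i hi => ?_) ?_
  · rw [X_dvd_coeff_toSeriesPoly_iff, coeff_zero_coeff_genericQ_of_lt hi]
  · rw [X_dvd_coeff_toSeriesPoly_iff, coeff_zero_coeff_genericQ_self]
    exact genericCoeff_ne_zero _ _ _

end GenericDiagonal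

/-! ### Clearing denominators in `k(t)[Δ]` -/

section Numerators

variable {k : Type*} [Field k] {Ψ : (RatFunc k)[X]} {Φ : k[X][X]}

/-- Every polynomial over `k(t)` has a numerator. -/
lemma exists_isNumer (Ψ : (RatFunc k)[X]) : ∃ Φ, IsNumer Ψ Φ := by
  obtain ⟨b, hb, h⟩ := IsLocalization.integerNormalization_spec (nonZeroDivisors k[X]) Ψ
  set p := IsLocalization.integerNormalization (nonZeroDivisors k[X]) Ψ
  have hb0 : b ≠ 0 := nonZeroDivisors.ne_zero hb
  obtain ⟨e, Φ, g, hrel, he, hΦ⟩ :=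
    UniqueFactorizationMonoid.exists_reduced_factors (C b : k[X][X]) (C_ne_zero.2 hb0) p
  have hg0 : g ≠ 0 := by rintro rfl; exact hb0 (C_eq_zero.1 (by rw [← he, zero_mul]))
  have he0 : e ≠ 0 := by rintro rfl; exact hb0 (C_eq_zero.1 (by rw [← he, mul_zero]))
  have hdeg := natDegree_mul hg0 he0
  rw [he, natDegree_C] at hdeg
  -- A factor of the constant polynomial `C b` is itself constant in `Δ`.
  obtain ⟨e', rfl⟩ := natDegree_eq_zero.1 (show e.natDegree = 0 by omega)
  refine ⟨Φ, e', C_ne_zero.1 he0, hrel.symm, ?_⟩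
  have hmap : overRatFunc p = C (algebraMap k[X] (RatFunc k) b) * Ψ := by
    rw [overRatFunc, h]
    ext i
    rw [coeff_smul, coeff_C_mul, Algebra.smul_def]
  apply mul_left_cancel₀ (overRatFunc_ne_zero hg0)
  have h1 : overRatFunc g * overRatFunc Φ = overRatFunc p := by
    rw [← hΦ, overRatFunc, overRatFunc, overRatFunc, Polynomial.map_mul]
  have h2 : overRatFunc g * C (algebraMap k[X] (RatFunc k) e') =
      C (algebraMap k[X] (RatFunc k) b) := by
    rw [overRatFunc, ← map_C, ← Polynomial.map_mul, he, map_C]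
  rw [h1, hmap, ← mul_assoc, h2]

lemma IsNumer.exists_eq (h : IsNumer Ψ Φ) : ∃ e : RatFunc k, e ≠ 0 ∧ overRatFunc Φ = C e * Ψ := by
  obtain ⟨e, he, -, h⟩ := h
  exact ⟨_, (map_ne_zero_iff _ (IsFractionRing.injective _ _)).2 he, h⟩

lemma IsNumer.irreducible (h : IsNumer Ψ Φ) (hΨ : Irreducible Ψ) :
    Irreducible (overRatFunc Φ) := by
  obtain ⟨e, he, h⟩ := h.exists_eq
  rw [h]
  exact (irreducible_isUnit_mul (isUnit_C.2 he.isUnit)).2 hΨ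

lemma IsNumer.natDegree_eq (h : IsNumer Ψ Φ) : (overRatFunc Φ).natDegree = Ψ.natDegree := by
  obtain ⟨e, he, h⟩ := h.exists_eq
  rw [h, natDegree_C_mul he]

end Numerators

/-! ### Comparing `k(t)`, `k⟦t⟧` and the algebraic closure of `k((t))` -/

section Embeddings

variable {k : Type*} [Field k]

local notation "Ω" => AlgebraicClosure (LaurentSeries k)

lemma polyToBranches_injective : Function.Injective (polyToBranches k) :=
  algebraMap_powerSeries_injective.comp (Polynomial.coe_injective k)

/-- The embedding of `k(t)` in the algebraic closure of `k((t))`. -/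
def ratFuncToBranches (k : Type*) [Field k] : RatFunc k →+* AlgebraicClosure (LaurentSeries k) :=
  IsFractionRing.lift (A := k[X]) (polyToBranches_injective (k := k))

lemma map_overRatFunc (P : k[X][X]) :
    (overRatFunc P).map (ratFuncToBranches k) = P.map (polyToBranches k) := by
  rw [overRatFunc, Polynomial.map_map]
  congr 1
  refine RingHom.ext fun a => ?_
  rw [RingHom.comp_apply, ratFuncToBranches, IsFractionRing.lift_algebraMap]

lemma map_toSeriesPoly (P : k[X][X]) :
    (toSeriesPoly k P).map (algebraMap (PowerSeries k) Ω) = P.map (polyToBranches k) := by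
  rw [toSeriesPoly, coe_mapRingHom, Polynomial.map_map, polyToBranches]

/-- A power series is a root of the numerator if it is a root of the polynomial. -/
lemma IsNumer.eval₂_eq_zero {Ψ : (RatFunc k)[X]} {Φ : k[X][X]} (h : IsNumer Ψ Φ)
    {f : PowerSeries k}
    (hf : (Ψ.map (ratFuncToBranches k)).IsRoot (algebraMap (PowerSeries k) Ω f)) :
    eval₂ coeToPowerSeries.ringHom f Φ = 0 := by
  obtain ⟨e, -, he⟩ := h.exists_eq
  apply algebraMap_powerSeries_injective (k := k)
  rw [map_zero, hom_eval₂, ← polyToBranches, ← eval_map, ← map_overRatFunc, he,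
    Polynomial.map_mul, eval_mul, hf.eq_zero, mul_zero]

open scoped RatFunc in
lemma natDegree_seriesMinpoly {Φ : k[X][X]} {f : PowerSeries k}
    (hirr : Irreducible (overRatFunc Φ)) (hf : eval₂ coeToPowerSeries.ringHom f Φ = 0) :
    (seriesMinpoly f).natDegree = (overRatFunc Φ).natDegree := by
  have hcomp : (algebraMap (RatFunc k) (LaurentSeries k)).comp (algebraMap k[X] (RatFunc k)) =
      (algebraMap (PowerSeries k) (LaurentSeries k)).comp coeToPowerSeries.ringHom := by
    refine RingHom.ext fun a => ?_
    rw [RingHom.comp_apply, RingHom.comp_apply, ← IsScalarTower.algebraMap_apply]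
    rfl
  have h0 : aeval (algebraMap (PowerSeries k) (LaurentSeries k) f) (overRatFunc Φ) = 0 := by
    rw [aeval_def, overRatFunc, eval₂_map, hcomp, ← hom_eval₂, hf, map_zero]
  rw [seriesMinpoly, ← minpoly.eq_of_irreducible hirr h0, natDegree_mul_C]
  exact inv_ne_zero (leadingCoeff_ne_zero.2 hirr.ne_zero)

end Embeddings

/-! ### Assembly for the generic denominator -/

section Generic

variable {dx dy : ℕ} {A : MvPolynomial (Fin 2) (GenericField dx dy)}

local notation "Ω" => AlgebraicClosure (LaurentSeries (GenericField dx dy))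

lemma irreducible_overRatFunc_genericQ (h : 0 < dx + dy) :
    Irreducible (overRatFunc (genericQ dx dy)) := by
  obtain ⟨θ, l, Y, hY⟩ := exists_hasSymmetricRoots dx dy (FractionRing
    (MvPolynomial (Fin (dx + dy)) (RatFunc (GenericField dx dy))))
  have : Nonempty (Fin (dx + dy)) := ⟨⟨0, h⟩⟩
  exact hY.irreducible

lemma overRatFunc_C_C_mul {k : Type*} [Field k] (a : k) (P : k[X][X]) :
    overRatFunc (C (C a) * P) = C (algebraMap k[X] (RatFunc k) (C a)) * overRatFunc P := by
  rw [overRatFunc, Polynomial.map_mul, map_C, overRatFunc]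

lemma HasSymmetricRoots.C_mul {K E ι : Type*} [Field K] [Field E] [Fintype ι] {θ : K →+* E}
    {Q : K[X]} {l : E} {Y : ι → E} (h : HasSymmetricRoots θ Q l Y) {a : K} (ha : a ≠ 0) :
    HasSymmetricRoots θ (C a * Q) (θ a * l) Y := by
  refine ⟨mul_ne_zero ((map_ne_zero θ).2 ha) h.1, h.2.1, ?_, h.2.2.2⟩
  rw [Polynomial.map_mul, h.2.2.1, map_C, Polynomial.C_mul, mul_assoc]

/-- The branches of the generic denominator, the small ones first. The diagonal is the sum of the
residues at the small ones. -/
theorem exists_branches (hx : A.degreeOf 0 < dx) {a : GenericField dx dy} (ha : a ≠ 0) :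
    ∃ (l : Ω) (Y : Fin dx ⊕ Fin dy → Ω), l ≠ 0 ∧ Function.Injective Y ∧
      (C (C a) * genericQ dx dy).map (polyToBranches _) = C l * ∏ i, (X - C (Y i)) ∧
      numSmallBranches (C (C a) * genericQ dx dy) = dx ∧
      ∑ i : Fin dx, ((C (C a) * diagNumer (dx - 1) A).map (polyToBranches _)).eval (Y (Sum.inl i)) /
        (derivative ((C (C a) * genericQ dx dy).map (polyToBranches _))).eval (Y (Sum.inl i)) =
        algebraMap (PowerSeries (GenericField dx dy)) Ω (ratDiag A (genericB dx dy)) := by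
  obtain ⟨W, H, U, V, h⟩ := exists_isSmallFactorization_genericQ
    (toSeriesPoly _ (diagNumer (dx - 1) A))
  have hinj : Function.Injective (coeToPowerSeries.ringHom (R := GenericField dx dy)) :=
    Polynomial.coe_injective _
  have hb : polyToBranches _ (C a) ≠ 0 :=
    (map_ne_zero_iff _ polyToBranches_injective).2 (C_ne_zero.2 ha)
  obtain ⟨l, Y, hl, hY, hprod, hsmall, hsum⟩ := h.exists_branches (d := dy) (by omega) (by
      rw [toSeriesPoly, coe_mapRingHom, natDegree_map_eq_of_injective hinj, natDegree_genericQ]) (by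
      rw [toSeriesPoly, coe_mapRingHom, Ne, Polynomial.map_eq_zero_iff hinj]
      exact genericQ_ne_zero) (by
      rw [map_toSeriesPoly, ← map_overRatFunc, separable_map]
      exact (irreducible_overRatFunc_genericQ (by omega)).separable)
  rw [map_toSeriesPoly] at hprod hsmall hsum
  rw [map_toSeriesPoly, h.coeff_eq_ratDiag hx] at hsum
  refine ⟨polyToBranches _ (C a) * l, Y, mul_ne_zero hb hl, hY, ?_, ?_, ?_⟩
  · rw [Polynomial.map_mul, hprod, map_C, C_mul, mul_assoc]
  · have hset : {y | ((C (C a) * genericQ dx dy).map (polyToBranches _)).IsRoot y ∧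
        TendsToZero y} = Set.range (fun i => Y (Sum.inl i)) := by
      rw [← hsmall]
      ext y
      simp [Polynomial.map_mul, IsRoot, hb]
    rw [numSmallBranches, hset, ← Set.image_univ, Set.ncard_image_of_injective, Set.ncard_univ,
      Nat.card_fin]
    exact hY.comp Sum.inl_injective
  · rw [← hsum]
    refine Finset.sum_congr rfl fun i _ => ?_
    rw [Polynomial.map_mul, Polynomial.map_mul, map_C, derivative_C_mul, eval_mul, eval_mul,
      eval_C, mul_div_mul_left _ _ hb]

variable (hA : A ≠ 0) (hx : A.degreeOf 0 < dx) (hy : A.degreeOf 1 < dy)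

include hA hx hy

theorem exists_isAlgebraicDiagonal : ∃ Φ, IsAlgebraicDiagonal A (genericB dx dy) Φ := by
  have hQ := irreducible_overRatFunc_genericQ (dx := dx) (dy := dy) (by omega)
  obtain ⟨R, hR⟩ := exists_isAlgebraicResidues (overRatFunc (diagNumer (dx - 1) A)) hQ
  obtain ⟨Φ, hΦ⟩ := exists_isNumer (pureComposedSum R (numSmallBranches (genericQ dx dy)))
  exact ⟨Φ, _, _, R, isReducedForm_genericQ hQ hA hx hy, hR, hΦ⟩

/-- Two splittings of `Q` are used: the one with indeterminate roots for irreducibility and degree,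
and the one by branches over `k((t))` for the root. Only statements over `k(t)` pass from the first
to the second, so the two need not be identified. -/
theorem IsAlgebraicDiagonal.irreducible_and_isRoot {Φ : (GenericField dx dy)[X][X]}
    (h : IsAlgebraicDiagonal A (genericB dx dy) Φ) :
    Irreducible (overRatFunc Φ) ∧ (overRatFunc Φ).natDegree = (dx + dy).choose dx ∧
      eval₂ coeToPowerSeries.ringHom (ratDiag A (genericB dx dy)) Φ = 0 := by
  obtain ⟨P, Q, R, hred, hR, hΦ⟩ := h
  have hQ := irreducible_overRatFunc_genericQ (dx := dx) (dy := dy) (by omega)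
  obtain ⟨a, ha, rfl, rfl⟩ := hred.eq_C_mul hQ hA hx hy
  obtain ⟨l, Y, hl, hY, hprod, hsmall, hsum⟩ := exists_branches hx ha
  rw [hsmall] at hΦ
  have ha' : algebraMap (GenericField dx dy)[X] (RatFunc (GenericField dx dy)) (C a) ≠ 0 :=
    (map_ne_zero_iff _ (IsFractionRing.injective _ _)).2 (C_ne_zero.2 ha)
  obtain ⟨θ, l', Y', hY'⟩ := exists_hasSymmetricRoots dx dy (FractionRing
    (MvPolynomial (Fin (dx + dy)) (RatFunc (GenericField dx dy))))
  have hsymm := hY'.C_mul ha'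
  rw [← overRatFunc_C_C_mul] at hsymm
  have hP0 : C (C a) * diagNumer (dx - 1) A ≠ 0 :=
    mul_ne_zero (C_ne_zero.2 (C_ne_zero.2 ha)) (diagNumer_ne_zero hA (by omega))
  obtain ⟨hirr, hdeg⟩ := hsymm.irreducible_pureComposedSum (overRatFunc_ne_zero hP0) (by
    rw [natDegree_overRatFunc, Fintype.card_fin, natDegree_C_mul (C_ne_zero.2 ha)]
    exact natDegree_diagNumer_add_two_le hx hy) hR (c := dx) (by omega)
    (by rw [Fintype.card_fin]; omega)
  rw [Fintype.card_fin] at hdeg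
  refine ⟨hΦ.irreducible hirr, hΦ.natDegree_eq.trans hdeg, hΦ.eval₂_eq_zero ?_⟩
  have hQ' : Irreducible (overRatFunc (C (C a) * genericQ dx dy)) := by
    rw [overRatFunc_C_C_mul]
    exact (irreducible_isUnit_mul (isUnit_C.2 ha'.isUnit)).2 hQ
  rw [← map_overRatFunc] at hprod
  obtain ⟨u, hu, hRm⟩ := hR.map_eq _ hQ' hl hY hprod
  have : CharZero Ω := ((ratFuncToBranches (GenericField dx dy)).charZero_iff
    (ratFuncToBranches _).injective).1
    inferInstance
  -- The degree found by symmetry shows that no sum of `dx` residues vanishes among the branches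
  -- either.
  rw [map_pureComposedSum_of_natDegree _ hu hRm dx (by simpa using hdeg), IsRoot, eval_prod]
  -- The vanishing factor is the one for the set of all small branches.
  refine Finset.prod_eq_zero (i := Finset.univ.map Function.Embedding.inl) ?_ ?_
  · simp [Finset.mem_powersetCard]
  · rw [Finset.sum_map, eval_sub, eval_X, eval_C, ← hsum, map_overRatFunc, map_overRatFunc]
    exact sub_self _

end Generic

lemma extendA_ne_zero {dx dy : ℕ} {A : MvPolynomial (Fin 2) ℚ} (hA : A ≠ 0) :
    extendA dx dy A ≠ 0 :=
  (map_ne_zero_iff _ (MvPolynomial.map_injective _ (algebraMap ℚ _).injective)).2 hA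

lemma degreeOf_extendA {dx dy : ℕ} (A : MvPolynomial (Fin 2) ℚ) (i : Fin 2) :
    (extendA dx dy A).degreeOf i = A.degreeOf i := by
  classical
  rw [extendA, MvPolynomial.degreeOf_def, MvPolynomial.degreeOf_def,
    MvPolynomial.degrees_map_of_injective _ (algebraMap ℚ _).injective]

/-- With `a` the minimum, the binomial is at least `binom(2a, a)`, and successive central binomials
grow by the factor `2(2a+1)/(a+1) ≥ 2`. -/
lemma two_pow_min_le_choose (m n : ℕ) : 2 ^ min m n ≤ (m + n).choose m := by
  have key : ∀ a b : ℕ, 2 ^ a ≤ (a + (a + b)).choose a := fun a b =>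
    calc 2 ^ a ≤ a.centralBinom := by
          induction a with
          | zero => simp
          | succ a ih =>
            have h1 := Nat.succ_mul_centralBinom_succ a
            refine Nat.le_of_mul_le_mul_left (?_ : (a + 1) * _ ≤ (a + 1) * _) a.succ_pos
            rw [h1, pow_succ]
            nlinarith [Nat.zero_le (a * a.centralBinom)]
      _ = (2 * a).choose a := rfl
      _ ≤ (a + (a + b)).choose a := Nat.choose_le_choose a (by omega)
  rcases le_total m n with h | h
  · obtain ⟨b, rfl⟩ := Nat.exists_eq_add_of_le h
    rw [min_eq_left h]
    exact key m b
  · obtain ⟨b, rfl⟩ := Nat.exists_eq_add_of_le h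
    rw [min_eq_right h, add_comm (n + b), ← Nat.choose_symm_add]
    exact key n b

end AlgDiag

end


theorem mainTheorem2 (dx dy : ℕ) (A : MvPolynomial (Fin 2) ℚ) (hA : A ≠ 0)
    (hAx : A.degreeOf 0 < dx) (hAy : A.degreeOf 1 < dy) :
    (∃ Φ, AlgDiag.IsAlgebraicDiagonal (AlgDiag.extendA dx dy A) (AlgDiag.genericB dx dy) Φ) ∧
    (∀ Φ, AlgDiag.IsAlgebraicDiagonal (AlgDiag.extendA dx dy A) (AlgDiag.genericB dx dy) Φ →
      Irreducible (AlgDiag.overRatFunc Φ) ∧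
      (AlgDiag.overRatFunc Φ).natDegree = (dx + dy).choose dx ∧
      Polynomial.eval₂ Polynomial.coeToPowerSeries.ringHom
        (AlgDiag.ratDiag (AlgDiag.extendA dx dy A) (AlgDiag.genericB dx dy)) Φ = 0) ∧
    (AlgDiag.seriesMinpoly
      (AlgDiag.ratDiag (AlgDiag.extendA dx dy A) (AlgDiag.genericB dx dy))).natDegree =
        (dx + dy).choose dx ∧
    2 ^ min dx dy ≤ (AlgDiag.seriesMinpoly
      (AlgDiag.ratDiag (AlgDiag.extendA dx dy A) (AlgDiag.genericB dx dy))).natDegree := by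
  have hA' := AlgDiag.extendA_ne_zero (dx := dx) (dy := dy) hA
  rw [← AlgDiag.degreeOf_extendA (dx := dx) (dy := dy)] at hAx hAy
  have hex := AlgDiag.exists_isAlgebraicDiagonal hA' hAx hAy
  have hall := fun Φ (h : AlgDiag.IsAlgebraicDiagonal (AlgDiag.extendA dx dy A)
    (AlgDiag.genericB dx dy) Φ) => h.irreducible_and_isRoot hA' hAx hAy
  obtain ⟨Φ, hΦ⟩ := id hex
  obtain ⟨h1, h2, h3⟩ := hall Φ hΦ
  have hmin := (AlgDiag.natDegree_seriesMinpoly h1 h3).trans h2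
  exact ⟨hex, hall, hmin, hmin ▸ AlgDiag.two_pow_min_le_choose dx dy⟩
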